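/- **Setting.** Let $\Gamma_2=\mathbb{Z}[x,x^{-1},(1+x)^{-1}]\rtimes\mathbb{Z}^2$ be the Baumslag–Remeslennikov group: its elements are pairs $(f,(h_0,h_1))$, with multiplication $(f,h)(f',h')=(f+f'\,x^{h_0}(1+x)^{h_1},\,h+h')$. Let $e_0=(1,0)$ and $e_1=(0,1)$. Let $\mathcal{T}$ be the tree in which every vertex has $1+|\mathbb{Z}|$ neighbours, with edges of length one, and let $\rho$ be a directed geodesic $\mathbb{R}\to\mathcal{T}$ that sends the integers to vertices. The height of a point $p$ of $\mathcal{T}$ is $h(p)=\rho^{-1}(q)+d(p,q)$, where $q$ is the point of $\rho$ closest to $p$. The horocyclic product of three copies of $\mathcal{T}$ is $$\mathcal{H}_2(\mathbb{Z})=\{(p_0,p_1,p_2)\in\mathcal{T}^3 \mid h(p_0)+h(p_1)+h(p_2)=0\}.$$ It is a 2-complex: its open cells are the non-empty intersections of $\mathcal{H}_2(\mathbb{Z})$ with the open cells of the cubical complex $\mathcal{T}^3$, and its $k$-skeleton consists of the points at which at least $2-k$ of the heights $h(p_i)$ are integers. The Cayley 2-complex of a presentation is the universal cover of its presentation complex (one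 vertex, one loop for each generator, one 2-cell for each relator). Concretely, its 1-skeleton is the Cayley graph, with an edge labelled $a$ from $g$ to $ga$ for every group element $g$ and every generator $a$, and it has one 2-cell for every pair of a group element $g$ and a relator $r$, glued along the loop based at $g$ that spells $r$. **Theorem 1.3.** The group $\Gamma_2$ has the presentation $$\Gamma_2=\langle\,\lambda_i,\mu_i,\nu_i\ (i\in\mathbb{Z})\mid \lambda_i=\nu_i\mu_i,\ \ \lambda_{i+j}=\mu_i\nu_j\ \ (i,j\in\mathbb{Z})\,\rangle,$$ where $\lambda_i=(i,e_0)$, $\mu_i=(i,e_1)$ and $\nu_i=\lambda_i\mu_i^{-1}$, and $\mathcal{H}_2(\mathbb{Z})$ is the Cayley 2-complex of this presentation. That is, the complex just described, with its projection to the presentation complex, is the universal cover of the presentation complex, and it is isomorphic to $\mathcal{H}_2(\mathbb{Z})$ as a 2-complex: there are bijections between the vertices, between the edges and between the 2-cells of the two complexes, such that the end points of corresponding edges correspond, and such that the boundary loop of each 2-cell $(g,r)$ of the Cayley 2-complex corresponds to a closed edge-path that goes exactly once around the boundary of the corresponding 2-cell of $\mathcal{H}_2(\mathbb{Z})$. 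-/

import Mathlib

open scoped Polynomial

noncomputable section

/-! ### The group `Γ₂ = ℤ[x, x⁻¹, (1+x)⁻¹] ⋊ ℤ²` -/

/-- The ring `ℤ[x, x⁻¹, (1+x)⁻¹]`, i.e. `ℤ[x]` with `x` and `1 + x` inverted. -/
abbrev LaurentRing : Type :=
  Localization (Submonoid.closure ({Polynomial.X, 1 + Polynomial.X} : Set ℤ[X]))

/-- `x` as a unit of `ℤ[x, x⁻¹, (1+x)⁻¹]`. -/
def unitX : LaurentRingˣ :=
  (IsLocalization.map_units LaurentRing
    (⟨Polynomial.X, Submonoid.subset_closure (by simp)⟩ :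
      Submonoid.closure ({Polynomial.X, 1 + Polynomial.X} : Set ℤ[X]))).unit

/-- `1 + x` as a unit of `ℤ[x, x⁻¹, (1+x)⁻¹]`. -/
def unitOneAddX : LaurentRingˣ :=
  (IsLocalization.map_units LaurentRing
    (⟨1 + Polynomial.X, Submonoid.subset_closure (by simp)⟩ :
      Submonoid.closure ({Polynomial.X, 1 + Polynomial.X} : Set ℤ[X]))).unit

/-- The unit `x ^ h₀ (1 + x) ^ h₁` by which `h = (h₀, h₁) ∈ ℤ²` acts. -/
def actUnit (h : ℤ × ℤ) : LaurentRingˣ := unitX ^ h.1 * unitOneAddX ^ h.2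

theorem actUnit_zero : actUnit 0 = 1 := by simp [actUnit]

theorem actUnit_add (h k : ℤ × ℤ) : actUnit (h + k) = actUnit h * actUnit k := by
  simp only [actUnit, Prod.fst_add, Prod.snd_add, zpow_add]
  exact mul_mul_mul_comm _ _ _ _

/-- The Baumslag–Remeslennikov group `Γ₂`: pairs `(f, h)` with `f ∈ ℤ[x, x⁻¹, (1+x)⁻¹]` and
`h ∈ ℤ²`. -/
@[ext] structure Gamma2 : Type where
  poly : LaurentRing
  shift : ℤ × ℤ

namespace Gamma2

instance : One Gamma2 := ⟨⟨0, 0⟩⟩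

/-- `(f, h) (f', h') = (f + f' x ^ h₀ (1 + x) ^ h₁, h + h')`. -/
instance : Mul Gamma2 := ⟨fun g g' => ⟨g.poly + g'.poly * actUnit g.shift, g.shift + g'.shift⟩⟩

instance : Inv Gamma2 := ⟨fun g => ⟨-(g.poly * actUnit (-g.shift)), -g.shift⟩⟩

theorem one_def : (1 : Gamma2) = ⟨0, 0⟩ := rfl

theorem mul_def (g g' : Gamma2) :
    g * g' = ⟨g.poly + g'.poly * actUnit g.shift, g.shift + g'.shift⟩ := rfl

theorem inv_def (g : Gamma2) : g⁻¹ = ⟨-(g.poly * actUnit (-g.shift)), -g.shift⟩ := rfl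

instance : Group Gamma2 :=
  Group.ofLeftAxioms
    (by
      intro a b c
      simp only [mul_def, actUnit_add, Units.val_mul]
      ext1
      · ring
      · exact add_assoc _ _ _)
    (by
      intro a
      simp [mul_def, one_def, actUnit_zero])
    (by
      intro a
      simp [mul_def, inv_def, one_def])

end Gamma2

/-! ### Combinatorial 2-complexes, coverings, universal covers -/

/-- `IsEdgePath src tgt u p v`: the list `p` of oriented edges is an edge-path from `u` to `v`. -/
def IsEdgePath {V E : Type*} (src tgt : E → V) : V → List E → V → Prop
  | u, [], v => u = v
  | u, e :: p, v => src e = u ∧ IsEdgePath src tgt (tgt e) p v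

/-- A 2-dimensional cell complex, given combinatorially: vertices, oriented edges with a
fixed-point-free reversal (a geometric edge is a pair `{e, inv e}`), and 2-cells, each of them a
disc glued along a closed edge-path `attach f` that starts and ends at the vertex `base f`. -/
structure TwoComplex where
  V : Type
  E : Type
  F : Type
  src : E → V
  tgt : E → V
  inv : E → E
  inv_inv : ∀ e, inv (inv e) = e
  inv_ne : ∀ e, inv e ≠ e
  src_inv : ∀ e, src (inv e) = tgt e
  base : F → V
  attach : F → List E
  attach_closed : ∀ f, IsEdgePath src tgt (base f) (attach f) (base f)

namespace TwoComplex

/-- `p` is an edge-path of `X` from `u` to `v`. -/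
def IsPath (X : TwoComplex) (u : X.V) (p : List X.E) (v : X.V) : Prop :=
  IsEdgePath X.src X.tgt u p v

/-- Homotopy, with fixed end points, of edge-paths from `x` to `y`: the equivalence relation
generated by deleting a backtrack `e e⁻¹` and by deleting the boundary loop of a 2-cell. -/
inductive Homotopic (X : TwoComplex) (x y : X.V) : List X.E → List X.E → Prop
  | refl (p : List X.E) : Homotopic X x y p p
  | symm {p q : List X.E} : Homotopic X x y p q → Homotopic X x y q p
  | trans {p q r : List X.E} :
      Homotopic X x y p q → Homotopic X x y q r → Homotopic X x y p r
  | backtrack (u v : List X.E) (e : X.E) :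
      X.IsPath x u (X.src e) → X.IsPath (X.src e) v y →
      Homotopic X x y (u ++ [e, X.inv e] ++ v) (u ++ v)
  | face (u v : List X.E) (f : X.F) :
      X.IsPath x u (X.base f) → X.IsPath (X.base f) v y →
      Homotopic X x y (u ++ X.attach f ++ v) (u ++ v)

/-- `X` is non-empty, connected, and every closed edge-path is null-homotopic. -/
def IsSimplyConnected (X : TwoComplex) : Prop :=
  Nonempty X.V ∧ (∀ x y, ∃ p, X.IsPath x p y) ∧
    ∀ x p, X.IsPath x p x → X.Homotopic x x p []

/-- Combinatorial maps: cells go to cells of the same dimension, compatibly with the gluing. -/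
structure Hom (X Y : TwoComplex) where
  onV : X.V → Y.V
  onE : X.E → Y.E
  onF : X.F → Y.F
  src_onE : ∀ e, Y.src (onE e) = onV (X.src e)
  inv_onE : ∀ e, Y.inv (onE e) = onE (X.inv e)
  base_onF : ∀ f, Y.base (onF f) = onV (X.base f)
  attach_onF : ∀ f, Y.attach (onF f) = (X.attach f).map onE

/-- A combinatorial map is a covering when it is surjective on vertices and every edge, and every
2-cell, has exactly one lift at each lift of its initial (resp. base) vertex. -/
def Hom.IsCovering {X Y : TwoComplex} (p : Hom X Y) : Prop :=
  Function.Surjective p.onV ∧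
  (∀ (x : X.V) (e : Y.E), Y.src e = p.onV x → ∃! e' : X.E, X.src e' = x ∧ p.onE e' = e) ∧
  (∀ (x : X.V) (f : Y.F), Y.base f = p.onV x → ∃! f' : X.F, X.base f' = x ∧ p.onF f' = f)

/-- A universal cover is a covering by a simply connected complex. -/
def Hom.IsUniversalCover {X Y : TwoComplex} (p : Hom X Y) : Prop :=
  p.IsCovering ∧ X.IsSimplyConnected

end TwoComplex

/-! ### Presentations: presentation complex and Cayley 2-complex

A presentation is a set of relators, which are words in the letters `(a, true)`, standing for the
generator `a`, and `(a, false)`, standing for `a⁻¹`. -/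

/-- The group `⟨α | rels⟩`. -/
abbrev PresGroup {α : Type} (rels : Set (List (α × Bool))) : Type :=
  PresentedGroup (FreeGroup.mk '' rels)

/-- The element of `⟨α | rels⟩` represented by a word. -/
def wordElt {α : Type} (rels : Set (List (α × Bool))) (w : List (α × Bool)) : PresGroup rels :=
  PresentedGroup.mk (FreeGroup.mk '' rels) (FreeGroup.mk w)

theorem wordElt_nil {α : Type} (rels : Set (List (α × Bool))) : wordElt rels [] = 1 := by
  simp only [wordElt, ← FreeGroup.one_eq_mk, map_one]

theorem wordElt_cons {α : Type} (rels : Set (List (α × Bool))) (x : α × Bool)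
    (w : List (α × Bool)) : wordElt rels (x :: w) = wordElt rels [x] * wordElt rels w := by
  simp only [wordElt, ← map_mul, FreeGroup.mul_mk, List.singleton_append]

theorem wordElt_rel {α : Type} (rels : Set (List (α × Bool))) {w : List (α × Bool)}
    (hw : w ∈ rels) : wordElt rels w = 1 :=
  PresentedGroup.one_of_mem (Set.mem_image_of_mem _ hw)

theorem wordElt_flip {α : Type} (rels : Set (List (α × Bool))) (a : α) (b : Bool) :
    wordElt rels [(a, !b)] = (wordElt rels [(a, b)])⁻¹ := by
  simp [wordElt, ← map_inv, FreeGroup.inv_mk, FreeGroup.invRev]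

/-- The presentation complex: one vertex, one geometric edge for each generator, and one 2-cell for
each relator, glued along the loop that spells the relator. -/
def presentationComplex {α : Type} (rels : Set (List (α × Bool))) : TwoComplex where
  V := Unit
  E := α × Bool
  F := rels
  src := fun _ => ()
  tgt := fun _ => ()
  inv := fun e => (e.1, !e.2)
  inv_inv := by simp
  inv_ne := by
    rintro ⟨a, b⟩
    simp
  src_inv := fun _ => rfl
  base := fun _ => ()
  attach := fun r => r.1
  attach_closed := by
    intro r
    have h : ∀ w : List (α × Bool), IsEdgePath (fun _ : α × Bool => ()) (fun _ => ()) () w () := by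
      intro w
      induction w with
      | nil => rfl
      | cons e p ih => exact ⟨rfl, ih⟩
    exact h r.1

/-- The edge-path in the Cayley graph that starts at `g` and spells the word `w`. -/
def cayleyPath {α : Type} (rels : Set (List (α × Bool))) :
    PresGroup rels → List (α × Bool) → List (PresGroup rels × (α × Bool))
  | _, [] => []
  | g, x :: w => (g, x) :: cayleyPath rels (g * wordElt rels [x]) w

theorem isEdgePath_cayleyPath {α : Type} (rels : Set (List (α × Bool)))
    (w : List (α × Bool)) : ∀ g : PresGroup rels,
    IsEdgePath (fun e : PresGroup rels × (α × Bool) => e.1)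
      (fun e => e.1 * wordElt rels [e.2]) g (cayleyPath rels g w) (g * wordElt rels w) := by
  induction w with
  | nil =>
    intro g
    simp [cayleyPath, IsEdgePath, wordElt_nil]
  | cons x w ih =>
    intro g
    refine ⟨rfl, ?_⟩
    have h := ih (g * wordElt rels [x])
    rwa [mul_assoc, ← wordElt_cons] at h

theorem map_snd_cayleyPath {α : Type} (rels : Set (List (α × Bool)))
    (w : List (α × Bool)) : ∀ g : PresGroup rels, (cayleyPath rels g w).map Prod.snd = w := by
  induction w with
  | nil => intro g; rfl
  | cons x w ih => intro g; simp [cayleyPath, ih]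

/-- The Cayley 2-complex of the presentation `⟨α | rels⟩`.  Its 1-skeleton is the Cayley graph: the
vertices are the group elements and there is an edge labelled `a` from `g` to `g a` (whose
reverse is the edge labelled `a⁻¹` from `g a` to `g`).  It has a 2-cell for each `g` and each
relator `r`, glued along the translate by `g` of the loop at `1` that spells `r`. -/
def cayleyComplex {α : Type} (rels : Set (List (α × Bool))) : TwoComplex where
  V := PresGroup rels
  E := PresGroup rels × (α × Bool)
  F := PresGroup rels × rels
  src := fun e => e.1
  tgt := fun e => e.1 * wordElt rels [e.2]
  inv := fun e => (e.1 * wordElt rels [e.2], (e.2.1, !e.2.2))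
  inv_inv := by
    rintro ⟨g, a, b⟩
    simp [wordElt_flip]
  inv_ne := by
    rintro ⟨g, a, b⟩ h
    simp at h
  src_inv := fun _ => rfl
  base := fun f => f.1
  attach := fun f => cayleyPath rels f.1 f.2.1
  attach_closed := by
    rintro ⟨g, r, hr⟩
    have h := isEdgePath_cayleyPath rels r g
    rwa [wordElt_rel rels hr, mul_one] at h

/-- The projection of the Cayley 2-complex onto the presentation complex. -/
def cayleyProjection {α : Type} (rels : Set (List (α × Bool))) :
    TwoComplex.Hom (cayleyComplex rels) (presentationComplex rels) where
  onV := fun _ => ()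
  onE := fun e => e.2
  onF := fun f => f.2
  src_onE := fun _ => rfl
  inv_onE := fun _ => rfl
  base_onF := fun _ => rfl
  attach_onF := by
    rintro ⟨g, r⟩
    exact (map_snd_cayleyPath rels r.1 g).symm

/-! ### The presentation of `Γ₂` -/

/-- The generators `λ_i`, `μ_i`, `ν_i` (`i ∈ ℤ`). -/
inductive Gen : Type
  | lam (i : ℤ)
  | mu (i : ℤ)
  | nu (i : ℤ)

/-- The relators `λ_i⁻¹ ν_i μ_i` (i.e. `λ_i = ν_i μ_i`) and `λ_{i+j} ν_j⁻¹ μ_i⁻¹`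
(i.e. `λ_{i+j} = μ_i ν_j`). -/
def gammaRels : Set (List (Gen × Bool)) :=
  Set.range (fun i : ℤ => [(Gen.lam i, false), (Gen.nu i, true), (Gen.mu i, true)]) ∪
  Set.range (fun ij : ℤ × ℤ =>
    [(Gen.lam (ij.1 + ij.2), true), (Gen.nu ij.2, false), (Gen.mu ij.1, false)])

/-! ### Branching trees and their horocyclic products -/

section Horocyclic

variable {V : Type*}

/-- `T` is an `R`-branching tree: a tree in which every vertex has `1 + |R|` neighbours. -/
def IsBranchingTree (R : Type*) (T : SimpleGraph V) : Prop :=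
  T.IsTree ∧ ∀ v, Nonempty (T.neighborSet v ≃ Option R)

/-- `ρ` lists the vertices along a geodesic of `T` parametrised by `ℝ`. -/
def IsGeodesicLine (T : SimpleGraph V) (ρ : ℤ → V) : Prop :=
  ∀ i j : ℤ, (T.dist (ρ i) (ρ j) : ℤ) = |i - j|

/-- The height of a vertex `v`: if `ρ k` is the vertex of the line closest to `v`, it is
`k + d(v, ρ k)`. -/
def vertexHeight (T : SimpleGraph V) (ρ : ℤ → V) (v : V) : ℤ :=
  Function.argmin (fun k : ℤ => T.dist v (ρ k)) +
    T.dist v (ρ (Function.argmin (fun k : ℤ => T.dist v (ρ k))))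

/-- The cells of the graph `T`, given by their vertex sets: single vertices and edges. -/
def IsGraphCell (T : SimpleGraph V) (s : Set V) : Prop :=
  (∃ v, s = {v}) ∨ ∃ u v, T.Adj u v ∧ s = {u, v}

/-- The points of (the geometric realisation of) `T`, in barycentric coordinates. A point lies in the
interior of exactly one cell, the one spanned by the vertices at which its coordinate is not zero. -/
structure GraphPoint (T : SimpleGraph V) where
  coord : V →₀ ℝ
  isCell : IsGraphCell T (coord.support : Set V)
  nonneg : ∀ v, 0 ≤ coord v
  sum_eq_one : (coord.sum fun _ t => t) = 1

/-- The vertex set of the cell that has the point `p` in its interior. -/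
def GraphPoint.supp {T : SimpleGraph V} (p : GraphPoint T) : Set V := (p.coord.support : Set V)

/-- The height function on the points of `T`. On every edge it interpolates linearly between the
heights of the end points; this is `k + d(p, q)` with `q` the point of the line closest to `p`, and
`k` its parameter, because either `p` itself is on the line or `q` is the same vertex for
all points of the edge. -/
def pointHeight (T : SimpleGraph V) (ρ : ℤ → V) (p : GraphPoint T) : ℝ :=
  p.coord.sum fun v t => t * (vertexHeight T ρ v : ℝ)

/-- The horocyclic product of `n + 1` copies of `T`, as a set of points of `T ^ (n + 1)`. -/
def horocyclicProduct (n : ℕ) (T : SimpleGraph V) (ρ : ℤ → V) : Set (Fin (n + 1) → GraphPoint T) :=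
  {p | ∑ i, pointHeight T ρ (p i) = 0}

/-- The `k`-skeleton: at least `n - k` of the heights are integers. -/
def horoSkeleton (n : ℕ) (T : SimpleGraph V) (ρ : ℤ → V) (k : ℕ) :
    Set (Fin (n + 1) → GraphPoint T) :=
  {p | p ∈ horocyclicProduct n T ρ ∧
    n ≤ k + {i : Fin (n + 1) | ∃ m : ℤ, pointHeight T ρ (p i) = m}.ncard}

/-- The intersection of the horocyclic product with the open cell `∏ (s i)` of `T ^ (n + 1)`. -/
def horoOpenCell (n : ℕ) (T : SimpleGraph V) (ρ : ℤ → V) (s : Fin (n + 1) → Set V) :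
    Set (Fin (n + 1) → GraphPoint T) :=
  {p | p ∈ horocyclicProduct n T ρ ∧ ∀ i, (p i).supp = s i}

/-- The intersection of the horocyclic product with the closed cell `∏ (s i)` of `T ^ (n + 1)`. -/
def horoClosedCell (n : ℕ) (T : SimpleGraph V) (ρ : ℤ → V) (s : Fin (n + 1) → Set V) :
    Set (Fin (n + 1) → GraphPoint T) :=
  {p | p ∈ horocyclicProduct n T ρ ∧ ∀ i, (p i).supp ⊆ s i}

/-- The `k`-cells of the horocyclic product. They are given by those cells of the cubical complex
`T ^ (n + 1)` whose interior meets the horocyclic product, in points which belong to the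
`k`-skeleton and to no lower skeleton. -/
@[ext] structure HoroCell (n : ℕ) (T : SimpleGraph V) (ρ : ℤ → V) (k : ℕ) where
  carrier : Fin (n + 1) → Set V
  isCell : ∀ i, IsGraphCell T (carrier i)
  nonempty : (horoOpenCell n T ρ carrier).Nonempty
  dim_eq : ∀ p ∈ horoOpenCell n T ρ carrier,
    p ∈ horoSkeleton n T ρ k ∧ ∀ j < k, p ∉ horoSkeleton n T ρ j

/-- The cell `c` lies in the closed cell `d`. -/
def HoroCell.LiesIn {n : ℕ} {T : SimpleGraph V} {ρ : ℤ → V} {k l : ℕ}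
    (c : HoroCell n T ρ k) (d : HoroCell n T ρ l) : Prop :=
  horoOpenCell n T ρ c.carrier ⊆ horoClosedCell n T ρ d.carrier

/-- An isomorphism of 2-complexes from `X` onto the horocyclic product of three copies of `T`:
a bijection between the cells of each dimension, such that the end points of every edge correspond,
and such that the attaching loop of every 2-cell of `X` corresponds to a closed edge-path that goes
exactly once around the boundary of the corresponding 2-cell. -/
structure HoroIso (X : TwoComplex) (T : SimpleGraph V) (ρ : ℤ → V) where
  onV : X.V ≃ HoroCell 2 T ρ 0
  onE : X.E → HoroCell 2 T ρ 1
  onF : X.F ≃ HoroCell 2 T ρ 2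
  onE_surjective : Function.Surjective onE
  onE_eq_iff : ∀ e e', onE e = onE e' ↔ e' = e ∨ e' = X.inv e
  ends : ∀ e v, (onV v).LiesIn (onE e) ↔ v = X.src e ∨ v = X.tgt e
  boundary_nodup : ∀ f, ((X.attach f).map onE).Nodup
  boundary : ∀ f c, HoroCell.LiesIn c (onF f) ↔ c ∈ (X.attach f).map onE

end Horocyclic

end

/-! The presentation. Put a = λ_1 λ_0⁻¹, s = λ_0 and t = μ_0. The relators force λ_i = a^i s, μ_i =
a^i t and ν_i = t⁻¹ a^i s, make s and t commute, and give t a^i t⁻¹ = a^i · s a^i s⁻¹ for every i.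
Taking i = 1 and i = 2 shows that a commutes with s a s⁻¹ (`gamma_relations`). These few relations
already make all conjugates s^k a s^(-k) commute (`commute_conj_pow`), so the conjugates with k ≥ 0
generate an abelian image of ℤ[x] on which s and t act as x and 1 + x. Clearing denominators, every
element is a fraction times s^k t^l, and comparison with Γ₂ gives `presToGamma_bijective`.

The universal cover. For any presentation, the words that spell null-homotopic loops in the Cayley
2-complex form a normal subgroup of the free group that contains the relators, hence their normal
closure.

The geometry. The tree T is modelled on Laurent series: a vertex of height n is a series truncated
at degree n (`exists_treeCoordinates`). An element (f, h) is sent to the triple of truncated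
expansions of f at x = 0, x = -1 and x = ∞, cut off at the orders of u = x^h₀ (1+x)^h₁, up to a
shift by one at ∞. These orders h₀, h₁, -(h₀+h₁) add up to 0, so the triple lies in the horocyclic
product. Partial fractions show that every triple of height sum 0 arises exactly once
(`eq_zero_of_expand`, `exists_expand`). Right multiplication by a generator adds an integer multiple
of a unit to f; its orders show that one coordinate moves to a child, one to its parent, and one
stays. The leading coefficients of units are ±1, so the integer index of the generator reaches all
children.

The cells. A product of vertices and edges of T, the edges taken below vertices a_i, meets the
horocyclic product according to the number of edge factors and the sum S of the heights of the a_i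
(`nonempty_horoOpenCell_iff`). The 1-cells have two edge factors and S = 1; the 2-cells are
triangles with three edge factors and S = 1 or S = 2. The two values of S correspond to the relators
λ_c = ν_c μ_c and λ_{c+d} = μ_c ν_d. -/

/-! ### Baumslag's relations and the action of ℤ[x]. -/

section BaumslagRelations

variable {G : Type*} [Group G] {a s t : G}

/-- Write a_k = s^k a s^(-k); conjugation by t sends a_k to a_k a_{k+1}. If a commutes with a_{n+1},
then conjugation by t makes a a_1 commute with a_{n+1} a_{n+2}. By shifted induction hypotheses a_1
commutes with both of these factors, so a_1 can be cancelled, and then a_{n+1}, which leaves a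
commuting with a_{n+2}. -/
theorem commute_conj_pow (hst : Commute s t) (hrel : t * a * t⁻¹ = a * (s * a * s⁻¹))
    (hcomm : Commute a (s * a * s⁻¹)) (k : ℕ) :
    Commute a (MulAut.conj (s ^ k) a) := by
  have ht : ∀ k : ℕ, MulAut.conj t (MulAut.conj (s ^ k) a) =
      MulAut.conj (s ^ k) a * MulAut.conj (s ^ (k + 1)) a := by
    intro k
    have h1 : MulAut.conj t (MulAut.conj (s ^ k) a) = MulAut.conj (s ^ k) (MulAut.conj t a) := by
      rw [← MulAut.mul_apply, ← MulAut.mul_apply, ← map_mul, ← map_mul, (hst.symm.pow_right k).eq]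
    rw [h1, MulAut.conj_apply t, hrel, map_mul, ← MulAut.conj_apply s, ← MulAut.mul_apply,
      ← map_mul, ← pow_succ]
  have hs : ∀ i j : ℕ, MulAut.conj (s ^ i) (MulAut.conj (s ^ j) a) =
      MulAut.conj (s ^ (i + j)) a := by
    intro i j
    rw [← MulAut.mul_apply, ← map_mul, ← pow_add]
  induction k using Nat.strong_induction_on with
  | _ k ih =>
    match k with
    | 0 => simp
    | 1 => simpa using hcomm
    | n + 2 =>
      have e0 : Commute a (MulAut.conj (s ^ (n + 1)) a) := ih (n + 1) (by omega)
      have e1 : Commute (MulAut.conj (s ^ 1) a) (MulAut.conj (s ^ (n + 1)) a) := by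
        have h := (ih n (by omega)).map (MulAut.conj (s ^ 1))
        rwa [hs, add_comm 1] at h
      have e2 : Commute (MulAut.conj (s ^ 1) a) (MulAut.conj (s ^ (n + 2)) a) := by
        have h := (ih (n + 1) (by omega)).map (MulAut.conj (s ^ 1))
        rwa [hs, add_comm 1] at h
      have e3 := e0.map (MulAut.conj t)
      have h0 := ht 0
      simp only [pow_zero, map_one, MulAut.one_apply, zero_add] at h0
      rw [ht, h0] at e3
      have e4 : Commute a (MulAut.conj (s ^ (n + 1)) a * MulAut.conj (s ^ (n + 2)) a) := by
        have := e3.mul_left (e1.mul_right e2).inv_left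
        rwa [mul_inv_cancel_right] at this
      have := e0.inv_right.mul_right e4
      rwa [inv_mul_cancel_left] at this

open scoped IsMulCommutative in
-- Since the conjugates s^k a s^(-k) commute, sending x^k to the k-th one extends additively.
-- Multiplication by x shifts k, which is conjugation by s; t acts as 1 + x because it sends each
-- conjugate to its product with the next one.
theorem exists_polynomial_hom (hst : Commute s t) (hrel : t * a * t⁻¹ = a * (s * a * s⁻¹))
    (hcomm : Commute a (s * a * s⁻¹)) :
    ∃ p : Multiplicative ℤ[X] →* G, p (.ofAdd 1) = a ∧
      (∀ P, s * p (.ofAdd P) * s⁻¹ = p (.ofAdd (Polynomial.X * P))) ∧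
      ∀ P, t * p (.ofAdd P) * t⁻¹ = p (.ofAdd ((1 + Polynomial.X) * P)) := by
  let c : ℕ → G := fun k => MulAut.conj (s ^ k) a
  have hc : ∀ i j, c i * c j = c j * c i := by
    have key : ∀ i d, Commute (c i) (c (i + d)) := by
      intro i d
      have h := (commute_conj_pow hst hrel hcomm d).map (MulAut.conj (s ^ i))
      rwa [← MulAut.mul_apply, ← map_mul, ← pow_add] at h
    intro i j
    rcases le_total i j with h | h
    · obtain ⟨d, rfl⟩ := Nat.exists_eq_add_of_le h
      exact key i d
    · obtain ⟨d, rfl⟩ := Nat.exists_eq_add_of_le h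
      exact (key j d).symm
  let B := Subgroup.closure (Set.range c)
  have : IsMulCommutative B := Subgroup.isMulCommutative_closure (by
    rintro _ ⟨i, rfl⟩ _ ⟨j, rfl⟩
    exact hc i j)
  let b : ℕ → Additive B := fun k => .ofMul ⟨c k, Subgroup.subset_closure ⟨k, rfl⟩⟩
  let q : ℤ[X] →ₗ[ℤ] Additive B := (Polynomial.basisMonomials ℤ).constr ℤ b
  let p : Multiplicative ℤ[X] →* G := B.subtype.comp (AddMonoidHom.toMultiplicativeLeft q.toAddMonoidHom)
  have hq : ∀ k, q (Polynomial.monomial k 1) = b k := by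
    intro k
    have := (Polynomial.basisMonomials ℤ).constr_basis ℤ b k
    rwa [Polynomial.coe_basisMonomials] at this
  have hp : ∀ k (z : ℤ), p (.ofAdd (Polynomial.monomial k z)) = c k ^ z := by
    intro k z
    have h1 : (Polynomial.monomial k z : ℤ[X]) = z • Polynomial.monomial k 1 := by
      rw [Polynomial.smul_monomial]; simp
    rw [h1, ofAdd_zsmul, map_zpow]
    congr 1
    change ((q (Polynomial.monomial k 1)).toMul : G) = c k
    rw [hq]
    rfl
  have hadd : ∀ P Q, p (.ofAdd (P + Q)) = p (.ofAdd P) * p (.ofAdd Q) := by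
    intro P Q
    rw [ofAdd_add, map_mul]
  have hsc : ∀ k, s * c k * s⁻¹ = c (k + 1) := by
    intro k
    change _ = MulAut.conj (s ^ (k + 1)) a
    rw [pow_succ', map_mul, MulAut.mul_apply, MulAut.conj_apply s]
  have htc : ∀ k, t * c k * t⁻¹ = c k * c (k + 1) := by
    intro k
    change MulAut.conj t (MulAut.conj (s ^ k) a) = _
    have h1 : MulAut.conj t (MulAut.conj (s ^ k) a) = MulAut.conj (s ^ k) (MulAut.conj t a) := by
      rw [← MulAut.mul_apply, ← MulAut.mul_apply, ← map_mul, ← map_mul, (hst.symm.pow_right k).eq]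
    rw [h1, MulAut.conj_apply t, hrel, map_mul, ← MulAut.conj_apply s, ← MulAut.mul_apply,
      ← map_mul, ← pow_succ]
  refine ⟨p, ?_, ?_, ?_⟩
  · have := hp 0 1
    simpa [c] using this
  · intro P
    induction P using Polynomial.induction_on' with
    | add P Q hP hQ => rw [mul_add, hadd, hadd, ← hP, ← hQ]; group
    | monomial n z =>
      rw [Polynomial.X_mul_monomial, hp, hp, ← hsc, conj_zpow]
  · intro P
    induction P using Polynomial.induction_on' with
    | add P Q hP hQ => rw [mul_add, hadd, hadd, ← hP, ← hQ]; group
    | monomial n z =>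
      rw [add_mul, one_mul, Polynomial.X_mul_monomial, hadd, hp, hp, ← conj_zpow, htc,
        (show Commute (c n) (c (n + 1)) from hc _ _).mul_zpow]

theorem polynomial_hom_conj_pow {p : Multiplicative ℤ[X] →* G}
    (hs : ∀ P, s * p (.ofAdd P) * s⁻¹ = p (.ofAdd (Polynomial.X * P)))
    (ht : ∀ P, t * p (.ofAdd P) * t⁻¹ = p (.ofAdd ((1 + Polynomial.X) * P))) (m n : ℕ) (P : ℤ[X]) :
    (s ^ m * t ^ n) * p (.ofAdd P) * (s ^ m * t ^ n)⁻¹ =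
      p (.ofAdd (Polynomial.X ^ m * (1 + Polynomial.X) ^ n * P)) := by
  induction m with
  | zero =>
    induction n with
    | zero => simp
    | succ n ih =>
      have := ht ((1 + Polynomial.X) ^ n * P)
      simp only [pow_zero, one_mul] at ih ⊢
      rw [pow_succ' t, pow_succ', mul_assoc (1 + _), ← this, ← ih]
      group
  | succ m ih =>
    rw [pow_succ' s, pow_succ', mul_assoc Polynomial.X, mul_assoc Polynomial.X, ← hs, ← ih]
    group

/-- Here b plays the role of a fraction P / (x^m (1+x)^n), and s^k t^l that of the ℤ²-component.
Fractions are closed under products and contain all conjugates of powers of a, so the form survives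
right multiplication by a, s, t and their inverses. -/
theorem exists_polynomial_normal_form (hst : Commute s t) {p : Multiplicative ℤ[X] →* G}
    (ha : p (.ofAdd 1) = a)
    (hs : ∀ P, s * p (.ofAdd P) * s⁻¹ = p (.ofAdd (Polynomial.X * P)))
    (ht : ∀ P, t * p (.ofAdd P) * t⁻¹ = p (.ofAdd ((1 + Polynomial.X) * P)))
    (htop : Subgroup.closure {a, s, t} = ⊤) (g : G) :
    ∃ (b : G) (m n : ℕ) (P : ℤ[X]) (k l : ℤ), g = b * (s ^ k * t ^ l) ∧
      (s ^ m * t ^ n) * b * (s ^ m * t ^ n)⁻¹ = p (.ofAdd P) := by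
  have hcomm : ∀ k l m n : ℤ, (s ^ k * t ^ l) * (s ^ m * t ^ n) = s ^ (k + m) * t ^ (l + n) := by
    intro k l m n
    rw [zpow_add, zpow_add, mul_assoc, ← mul_assoc (t ^ l), ((hst.zpow_zpow m l).symm).eq]
    group
  have hcommN : ∀ k l m n : ℕ, (s ^ k * t ^ l) * (s ^ m * t ^ n) = s ^ (k + m) * t ^ (l + n) := by
    intro k l m n
    exact_mod_cast hcomm k l m n
  have hmul : ∀ (b b' : G) (m n m' n' : ℕ) (P P' : ℤ[X]),
      (s ^ m * t ^ n) * b * (s ^ m * t ^ n)⁻¹ = p (.ofAdd P) →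
      (s ^ m' * t ^ n') * b' * (s ^ m' * t ^ n')⁻¹ = p (.ofAdd P') →
      ∃ (M N : ℕ) (Q : ℤ[X]), (s ^ M * t ^ N) * (b * b') * (s ^ M * t ^ N)⁻¹ = p (.ofAdd Q) := by
    intro b b' m n m' n' P P' h h'
    have e1 := polynomial_hom_conj_pow hs ht m' n' P
    have e2 := polynomial_hom_conj_pow hs ht m n P'
    rw [← h] at e1
    rw [← h'] at e2
    -- Addition of fractions over the product of the two denominators.
    refine ⟨m + m', n + n', Polynomial.X ^ m' * (1 + Polynomial.X) ^ n' * P +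
      Polynomial.X ^ m * (1 + Polynomial.X) ^ n * P', ?_⟩
    rw [ofAdd_add, map_mul, ← e1, ← e2]
    have e3 := hcommN m n m' n'
    have e4 := hcommN m' n' m n
    rw [add_comm m' m, add_comm n' n] at e4
    generalize s ^ m * t ^ n = c at *
    generalize s ^ m' * t ^ n' = c' at *
    have e5 : c' * (c * b * c⁻¹) * c'⁻¹ = (c' * c) * b * (c' * c)⁻¹ := by group
    have e6 : c * (c' * b' * c'⁻¹) * c⁻¹ = (c * c') * b' * (c * c')⁻¹ := by group
    rw [e5, e6, e3, e4]
    group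
  have hconj : ∀ (k l z : ℤ), ∃ (m n : ℕ) (Q : ℤ[X]),
      (s ^ m * t ^ n) * ((s ^ k * t ^ l) * a ^ z * (s ^ k * t ^ l)⁻¹) * (s ^ m * t ^ n)⁻¹ =
        p (.ofAdd Q) := by
    intro k l z
    have hz : p (.ofAdd (z • 1)) = a ^ z := by rw [ofAdd_zsmul, map_zpow, ha]
    -- The denominator with exponents |k| and |l| suffices, because |k| + k and |l| + l are
    -- non-negative.
    refine ⟨k.natAbs, l.natAbs, Polynomial.X ^ (k.natAbs + k).toNat *
      (1 + Polynomial.X) ^ (l.natAbs + l).toNat * (z • 1), ?_⟩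
    rw [← polynomial_hom_conj_pow hs ht, hz]
    have e := hcomm k.natAbs l.natAbs k l
    have e1 : ((k.natAbs + k).toNat : ℤ) = k.natAbs + k := by omega
    have e2 : ((l.natAbs + l).toNat : ℤ) = l.natAbs + l := by omega
    rw [← e1, ← e2] at e
    simp only [zpow_natCast] at e
    rw [← e]
    group
  have hstep : ∀ (g : G) (z : ℤ), (∃ (b : G) (m n : ℕ) (P : ℤ[X]) (k l : ℤ),
      g = b * (s ^ k * t ^ l) ∧ (s ^ m * t ^ n) * b * (s ^ m * t ^ n)⁻¹ = p (.ofAdd P)) →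
      ∃ (b : G) (m n : ℕ) (P : ℤ[X]) (k l : ℤ), g * a ^ z = b * (s ^ k * t ^ l) ∧
        (s ^ m * t ^ n) * b * (s ^ m * t ^ n)⁻¹ = p (.ofAdd P) := by
    rintro _ z ⟨b, m, n, P, k, l, rfl, hb⟩
    obtain ⟨m', n', Q, hQ⟩ := hconj k l z
    obtain ⟨M, N, R, hR⟩ := hmul _ _ _ _ _ _ _ _ hb hQ
    exact ⟨_, M, N, R, k, l, by group, hR⟩
  have hshift : ∀ (g : G) (z w : ℤ), (∃ (b : G) (m n : ℕ) (P : ℤ[X]) (k l : ℤ),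
      g = b * (s ^ k * t ^ l) ∧ (s ^ m * t ^ n) * b * (s ^ m * t ^ n)⁻¹ = p (.ofAdd P)) →
      ∃ (b : G) (m n : ℕ) (P : ℤ[X]) (k l : ℤ), g * (s ^ z * t ^ w) = b * (s ^ k * t ^ l) ∧
        (s ^ m * t ^ n) * b * (s ^ m * t ^ n)⁻¹ = p (.ofAdd P) := by
    rintro _ z w ⟨b, m, n, P, k, l, rfl, hb⟩
    exact ⟨b, m, n, P, k + z, l + w, by rw [mul_assoc, hcomm], hb⟩
  have hg : g ∈ Subgroup.closure {a, s, t} := htop ▸ Subgroup.mem_top g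
  induction hg using Subgroup.closure_induction_right with
  | one => exact ⟨1, 0, 0, 0, 0, 0, by simp, by simp⟩
  | mul_right x hx y hy ih =>
    rcases hy with rfl | rfl | rfl
    · simpa using hstep x 1 ih
    · simpa using hshift x 1 0 ih
    · simpa using hshift x 0 1 ih
  | mul_inv_cancel x hx y hy ih =>
    rcases hy with rfl | rfl | rfl
    · simpa using hstep x (-1) ih
    · simpa using hshift x (-1) 0 ih
    · simpa using hshift x 0 (-1) ih

end BaumslagRelations

/-! ### From the relators to Baumslag's relations. -/

section GammaRelations

variable {G : Type*} [Group G] {lam mu nu : ℤ → G}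

/-- The relations λ_{i+j} = μ_i ν_j make i ↦ λ_i λ_0⁻¹ additive, so it is i ↦ a^i with a = λ_1
λ_0⁻¹. Substituting into λ_i = ν_i μ_i gives one conjugation relation for each i; the cases i = 1
and i = 2 yield the last two conclusions. -/
theorem gamma_relations (h1 : ∀ i, lam i = nu i * mu i) (h2 : ∀ i j, lam (i + j) = mu i * nu j) :
    Commute (lam 0) (mu 0) ∧
    (∀ i, lam i = (lam 1 * (lam 0)⁻¹) ^ i * lam 0) ∧
    (∀ i, mu i = (lam 1 * (lam 0)⁻¹) ^ i * mu 0) ∧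
    (∀ i, nu i = (mu 0)⁻¹ * ((lam 1 * (lam 0)⁻¹) ^ i * lam 0)) ∧
    mu 0 * (lam 1 * (lam 0)⁻¹) * (mu 0)⁻¹ =
      (lam 1 * (lam 0)⁻¹) * (lam 0 * (lam 1 * (lam 0)⁻¹) * (lam 0)⁻¹) ∧
    Commute (lam 1 * (lam 0)⁻¹) (lam 0 * (lam 1 * (lam 0)⁻¹) * (lam 0)⁻¹) := by
  have hn0 : nu 0 = lam 0 * (mu 0)⁻¹ := by rw [h1 0]; group
  have hn0' : nu 0 = (mu 0)⁻¹ * lam 0 := by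
    have h := h2 0 0
    rw [add_zero] at h
    rw [h]; group
  have hst : lam 0 * mu 0 = mu 0 * lam 0 := by
    have h := h2 0 0
    rw [add_zero, hn0, ← mul_assoc, eq_mul_inv_iff_mul_eq] at h
    exact h
  have hmu : ∀ i, mu i = lam i * (lam 0)⁻¹ * mu 0 := by
    intro i
    have h := h2 i 0
    rw [add_zero, hn0'] at h
    rw [h]; group
  have hnu : ∀ i, nu i = (mu 0)⁻¹ * lam i := by
    intro i
    have h := h2 0 i
    rw [zero_add] at h
    rw [h]; group
  have hadd : ∀ i j, lam (i + j) * (lam 0)⁻¹ = (lam i * (lam 0)⁻¹) * (lam j * (lam 0)⁻¹) := by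
    intro i j
    rw [h2, hmu, hnu]; group
  let f : Multiplicative ℤ →* G := MonoidHom.mk' (fun z => lam z.toAdd * (lam 0)⁻¹)
    (fun i j => hadd i.toAdd j.toAdd)
  have hpow : ∀ i, lam i * (lam 0)⁻¹ = (lam 1 * (lam 0)⁻¹) ^ i := by
    intro i
    have h := map_zpow f (.ofAdd 1) i
    rw [← ofAdd_zsmul, smul_eq_mul, mul_one] at h
    exact h
  have hrel : ∀ i, mu 0 * (lam i * (lam 0)⁻¹) * (mu 0)⁻¹ =
      (lam i * (lam 0)⁻¹) * (lam 0 * (lam i * (lam 0)⁻¹) * (lam 0)⁻¹) := by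
    intro i
    have h := h1 i
    rw [hmu i, hnu i] at h
    have h' : mu 0 * lam i = lam i * lam i * (lam 0)⁻¹ * mu 0 := by
      conv_lhs => rw [h]
      group
    have h3 : (lam 0)⁻¹ * (mu 0)⁻¹ = (mu 0)⁻¹ * (lam 0)⁻¹ := by
      rw [← mul_inv_rev, ← mul_inv_rev, hst]
    rw [← mul_assoc, h', mul_assoc _ (lam 0)⁻¹ (mu 0)⁻¹, h3]
    group
  have hlam : ∀ i, lam i = (lam 1 * (lam 0)⁻¹) ^ i * lam 0 := by
    intro i
    rw [← hpow]; group
  refine ⟨hst, hlam, fun i => by rw [← hpow, hmu], fun i => by rw [hnu, ← hlam], hrel 1, ?_⟩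
  -- With b = s a s⁻¹, the case i = 2 reads t a² t⁻¹ = a² b², while squaring the case i = 1 gives (a
  -- b)². Cancelling the outer factors of abab = aabb leaves ba = ab.
  have e1 := hrel 1
  have e2 := hrel 2
  rw [hpow 2] at e2
  generalize lam 1 * (lam 0)⁻¹ = a at *
  generalize lam 0 = s at *
  generalize mu 0 = t at *
  rw [← conj_zpow, ← conj_zpow, e1] at e2
  rw [zpow_two, zpow_two, zpow_two] at e2
  generalize s * a * s⁻¹ = b at *
  have e3 : a * (b * a * b) = a * (a * b * b) := by
    simpa only [mul_assoc] using e2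
  exact (mul_right_cancel (mul_left_cancel e3)).symm

end GammaRelations

/-! ### The isomorphism of the presented group with Γ₂. -/

namespace Gamma2

theorem mk_zero_mul (h k : ℤ × ℤ) : (⟨0, h⟩ : Gamma2) * ⟨0, k⟩ = ⟨0, h + k⟩ := by
  simp [mul_def]

theorem mk_zero_zpow (h : ℤ × ℤ) (n : ℤ) : (⟨0, h⟩ : Gamma2) ^ n = ⟨0, n • h⟩ := by
  let f : Multiplicative (ℤ × ℤ) →* Gamma2 :=
    MonoidHom.mk' (fun h => ⟨0, h.toAdd⟩) (fun h k => (mk_zero_mul _ _).symm)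
  exact (map_zpow f (.ofAdd h) n).symm

theorem conj_mk_zero (h k : ℤ × ℤ) (f : LaurentRing) :
    (⟨0, h⟩ : Gamma2) * ⟨f, k⟩ * (⟨0, h⟩ : Gamma2)⁻¹ = ⟨f * actUnit h, k⟩ := by
  simp [mul_def, inv_def]

/-- The generators `λ_i`, `μ_i`, `ν_i` as elements of `Γ₂`. -/
noncomputable def ofGen : Gen → Gamma2
  | .lam i => ⟨i, (1, 0)⟩
  | .mu i => ⟨i, (0, 1)⟩
  | .nu i => ⟨i, (1, 0)⟩ * (⟨i, (0, 1)⟩ : Gamma2)⁻¹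

theorem actUnit_single_fst : (actUnit (1, 0) : LaurentRing) = algebraMap ℤ[X] _ Polynomial.X := by
  simp [actUnit, unitX]

theorem actUnit_single_snd :
    (actUnit (0, 1) : LaurentRing) = algebraMap ℤ[X] _ (1 + Polynomial.X) := by
  simp [actUnit, unitOneAddX]

theorem actUnit_fst_eq_snd_sub_one : (actUnit (1, 0) : LaurentRing) = actUnit (0, 1) - 1 := by
  rw [actUnit_single_fst, actUnit_single_snd, map_add, map_one]; ring

theorem actUnit_snd_mul_neg : (actUnit (0, 1) : LaurentRing) * actUnit (-(0, 1)) = 1 := by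
  rw [← Units.val_mul, ← actUnit_add, add_neg_cancel, actUnit_zero, Units.val_one]

/-- The polynomial component is i - i x / (1+x) = i / (1+x). Both families of relators reduce to
this identity. -/
theorem ofGen_nu (i : ℤ) :
    ofGen (.nu i) = ⟨i * (actUnit (-(0, 1)) : LaurentRing), (1, -1)⟩ := by
  simp only [ofGen, mul_def, inv_def]
  ext1
  · simp only [actUnit_fst_eq_snd_sub_one]
    linear_combination (-(i : LaurentRing)) * actUnit_snd_mul_neg
  · simp

theorem ofGen_lam_eq (i : ℤ) : ofGen (.lam i) = ofGen (.nu i) * ofGen (.mu i) := by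
  simp [ofGen]

theorem ofGen_lam_add (i j : ℤ) : ofGen (.lam (i + j)) = ofGen (.mu i) * ofGen (.nu j) := by
  rw [ofGen_nu]
  simp only [ofGen, mul_def]
  ext1
  · push_cast
    linear_combination (-(j : LaurentRing)) * actUnit_snd_mul_neg
  · simp

end Gamma2

theorem presGroup_lam_eq (i : ℤ) : (PresentedGroup.of (Gen.lam i) : PresGroup gammaRels) =
    PresentedGroup.of (Gen.nu i) * PresentedGroup.of (Gen.mu i) := by
  have h := wordElt_rel gammaRels (w := [(Gen.lam i, false), (Gen.nu i, true), (Gen.mu i, true)])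
    (Or.inl ⟨i, rfl⟩)
  rw [wordElt_cons, wordElt_cons _ (Gen.nu i, true)] at h
  have h' := wordElt_flip gammaRels (Gen.lam i) true
  rw [Bool.not_true] at h'
  rw [h', inv_mul_eq_one] at h
  exact h

theorem presGroup_lam_add (i j : ℤ) :
    (PresentedGroup.of (Gen.lam (i + j)) : PresGroup gammaRels) =
    PresentedGroup.of (Gen.mu i) * PresentedGroup.of (Gen.nu j) := by
  have h := wordElt_rel gammaRels
    (w := [(Gen.lam (i + j), true), (Gen.nu j, false), (Gen.mu i, false)]) (Or.inr ⟨(i, j), rfl⟩)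
  rw [wordElt_cons, wordElt_cons _ (Gen.nu j, false)] at h
  have h1 := wordElt_flip gammaRels (Gen.nu j) true
  have h2 := wordElt_flip gammaRels (Gen.mu i) true
  rw [Bool.not_true] at h1 h2
  rw [h1, h2, ← mul_inv_rev, mul_inv_eq_one] at h
  exact h

/-- The homomorphism from the abstract group of the presentation to `Γ₂`. -/
noncomputable def presToGamma : PresGroup gammaRels →* Gamma2 :=
  PresentedGroup.toGroup (f := Gamma2.ofGen) (by
    rintro _ ⟨r, hr | hr, rfl⟩
    · obtain ⟨i, rfl⟩ := hr
      simp [FreeGroup.lift_mk, Gamma2.ofGen_lam_eq]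
    · obtain ⟨⟨i, j⟩, rfl⟩ := hr
      simp [FreeGroup.lift_mk, Gamma2.ofGen_lam_add])

theorem presToGamma_of (x : Gen) : presToGamma (PresentedGroup.of x) = Gamma2.ofGen x :=
  PresentedGroup.toGroup.of _

theorem algebraMap_laurentRing_injective : Function.Injective (algebraMap ℤ[X] LaurentRing) := by
  apply IsLocalization.injective LaurentRing
    (M := Submonoid.closure ({Polynomial.X, 1 + Polynomial.X} : Set ℤ[X]))
  rw [Submonoid.closure_le]
  rintro P (rfl | rfl)
  · exact mem_nonZeroDivisors_of_ne_zero Polynomial.X_ne_zero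
  · refine mem_nonZeroDivisors_of_ne_zero ?_
    rw [add_comm]
    exact Polynomial.X_add_C_ne_zero (1 : ℤ)

theorem exists_eq_polynomial_mul_actUnit (f : LaurentRing) :
    ∃ (m n : ℕ) (P : ℤ[X]), f * actUnit (m, n) = algebraMap ℤ[X] _ P := by
  obtain ⟨⟨P, d, hd⟩, h⟩ := IsLocalization.surj
    (Submonoid.closure ({Polynomial.X, 1 + Polynomial.X} : Set ℤ[X])) f
  obtain ⟨m, n, rfl⟩ := (Submonoid.mem_closure_pair _ _ _).1 hd
  refine ⟨m, n, P, ?_⟩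
  rw [← h]
  congr 1
  simp [actUnit, unitX, unitOneAddX]

theorem actUnit_natCast (m n : ℕ) : (actUnit (m, n) : LaurentRing) =
    algebraMap ℤ[X] _ (Polynomial.X ^ m * (1 + Polynomial.X) ^ n) := by
  simp [actUnit, unitX, unitOneAddX]

/-- The composite of ℤ[x] → presented group → Γ₂ is the localization map, which is injective. The
normal form therefore detects trivial elements, and surjectivity is the statement that every element
of the localization is a fraction. -/
theorem presToGamma_bijective : Function.Bijective presToGamma := by
  obtain ⟨hst, hlam, hmu, hnu, hrel, hcomm⟩ := gamma_relations presGroup_lam_eq presGroup_lam_add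
  have hs := presToGamma_of (.lam 0)
  have ht := presToGamma_of (.mu 0)
  have ha : presToGamma (PresentedGroup.of (Gen.lam 1) * (PresentedGroup.of (Gen.lam 0))⁻¹) =
      ⟨1, 0⟩ := by
    rw [map_mul, map_inv, hs, presToGamma_of]
    simp [Gamma2.ofGen, Gamma2.mul_def, Gamma2.inv_def]
  have htop : Subgroup.closure {PresentedGroup.of (rels := FreeGroup.mk '' gammaRels) (Gen.lam 1) *
      (PresentedGroup.of (Gen.lam 0))⁻¹, PresentedGroup.of (Gen.lam 0),
      PresentedGroup.of (Gen.mu 0)} = ⊤ := by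
    rw [eq_top_iff, ← PresentedGroup.closure_range_of, Subgroup.closure_le]
    have h1 := Subgroup.subset_closure (G := PresGroup gammaRels) (k := {PresentedGroup.of
      (Gen.lam 1) * (PresentedGroup.of (Gen.lam 0))⁻¹, PresentedGroup.of (Gen.lam 0),
      PresentedGroup.of (Gen.mu 0)})
    have e1 := h1 (Or.inl rfl)
    have e2 := h1 (Or.inr (Or.inl rfl))
    have e3 := h1 (Or.inr (Or.inr rfl))
    rintro _ ⟨i | i | i, rfl⟩
    · rw [hlam i]
      exact mul_mem (zpow_mem e1 i) e2
    · rw [hmu i]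
      exact mul_mem (zpow_mem e1 i) e3
    · rw [hnu i]
      exact mul_mem (inv_mem e3) (mul_mem (zpow_mem e1 i) e2)
  obtain ⟨p, hp1, hps, hpt⟩ := exists_polynomial_hom hst hrel hcomm
  generalize PresentedGroup.of (rels := FreeGroup.mk '' gammaRels) (Gen.lam 1) *
      (PresentedGroup.of (Gen.lam 0))⁻¹ = a at *
  generalize PresentedGroup.of (rels := FreeGroup.mk '' gammaRels) (Gen.lam 0) = s at *
  generalize PresentedGroup.of (rels := FreeGroup.mk '' gammaRels) (Gen.mu 0) = t at *
  have hs' : presToGamma s = ⟨0, (1, 0)⟩ := by simp [hs, Gamma2.ofGen]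
  have ht' : presToGamma t = ⟨0, (0, 1)⟩ := by simp [ht, Gamma2.ofGen]
  have hd : ∀ k l : ℤ, presToGamma (s ^ k * t ^ l) = ⟨0, (k, l)⟩ := by
    intro k l
    rw [map_mul, map_zpow, map_zpow, hs', ht', Gamma2.mk_zero_zpow, Gamma2.mk_zero_zpow,
      Gamma2.mk_zero_mul]
    simp
  have hdN : ∀ k l : ℕ, presToGamma (s ^ k * t ^ l) = ⟨0, (k, l)⟩ := by
    intro k l
    exact_mod_cast hd k l
  have hp : ∀ P, presToGamma (p (.ofAdd P)) = ⟨algebraMap ℤ[X] _ P, 0⟩ := by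
    intro P
    induction P using Polynomial.induction_on with
    | C z =>
      have h1 : (Polynomial.C z : ℤ[X]) = z • 1 := by simp
      let j : Multiplicative LaurentRing →* Gamma2 :=
        MonoidHom.mk' (fun f => ⟨f.toAdd, 0⟩) (fun f g => by simp [Gamma2.mul_def, actUnit_zero])
      have h2 := map_zpow j (.ofAdd 1) z
      rw [← ofAdd_zsmul] at h2
      rw [h1, ofAdd_zsmul, map_zpow, map_zpow, hp1, ha, map_zsmul, map_one]
      exact h2.symm
    | add P Q hP hQ =>
      rw [ofAdd_add, map_mul, map_mul, hP, hQ, map_add]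
      simp [Gamma2.mul_def, actUnit_zero]
    | monomial n z ih =>
      have h1 : (Polynomial.C z * Polynomial.X ^ (n + 1) : ℤ[X]) =
        Polynomial.X * (Polynomial.C z * Polynomial.X ^ n) := by ring
      rw [h1, ← hps, map_mul, map_mul, map_inv, ih, hs', Gamma2.conj_mk_zero,
        Gamma2.actUnit_single_fst, ← map_mul, mul_comm]
  constructor
  · rw [injective_iff_map_eq_one]
    intro g hg
    obtain ⟨b, m, n, P, k, l, rfl, hb⟩ := exists_polynomial_normal_form hst hp1 hps hpt htop g
    have e1 := congrArg presToGamma hb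
    rw [map_mul, map_mul, map_inv, hdN, hp] at e1
    generalize hx : presToGamma b = x at e1
    obtain ⟨f, h⟩ := x
    rw [Gamma2.conj_mk_zero, Gamma2.mk.injEq] at e1
    obtain ⟨e1, rfl⟩ := e1
    rw [map_mul, hx, hd, Gamma2.mul_def, Gamma2.one_def, Gamma2.mk.injEq] at hg
    simp only [zero_mul, add_zero, zero_add, Prod.mk_eq_zero] at hg
    obtain ⟨rfl, rfl, rfl⟩ := hg
    -- The image of b has polynomial component 0, so P vanishes in the localization, hence in ℤ[x];
    -- then b is conjugate to 1.
    rw [zero_mul, eq_comm, map_eq_zero_iff _ algebraMap_laurentRing_injective] at e1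
    subst e1
    rw [ofAdd_zero, map_one, mul_inv_eq_one, mul_eq_left] at hb
    simp [hb]
  · rintro ⟨f, k, l⟩
    obtain ⟨m, n, P, h⟩ := exists_eq_polynomial_mul_actUnit f
    refine ⟨(s ^ m * t ^ n)⁻¹ * p (.ofAdd P) * (s ^ m * t ^ n) * (s ^ k * t ^ l), ?_⟩
    rw [map_mul, map_mul, map_mul, map_inv, hp, hd, hdN, ← h, ← Gamma2.conj_mk_zero]
    have e : ∀ c b : Gamma2, c⁻¹ * (c * b * c⁻¹) * c = b := fun c b => by group
    rw [e]
    simp [Gamma2.mul_def]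

/-- `Γ₂` has the presentation `⟨λ_i, μ_i, ν_i | λ_i = ν_i μ_i, λ_{i+j} = μ_i ν_j⟩`. -/
noncomputable def presEquivGamma : PresGroup gammaRels ≃* Gamma2 :=
  MulEquiv.ofBijective presToGamma presToGamma_bijective

theorem presEquivGamma_of (x : Gen) : presEquivGamma (PresentedGroup.of x) = Gamma2.ofGen x :=
  presToGamma_of x

/-! ### The Cayley 2-complex is the universal cover. -/

theorem IsEdgePath.append {V E : Type*} {src tgt : E → V} {p q : List E} {v w : V} :
    ∀ {u : V}, IsEdgePath src tgt u p v → IsEdgePath src tgt v q w →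
      IsEdgePath src tgt u (p ++ q) w := by
  induction p with
  | nil =>
    rintro u rfl hq
    exact hq
  | cons e p ih => exact fun hp hq => ⟨hp.1, ih hp.2 hq⟩

namespace TwoComplex

variable {X : TwoComplex}

theorem Homotopic.append_append {u v x y : X.V} {p q r s : List X.E}
    (hr : X.IsPath x r u) (hs : X.IsPath v s y) (h : X.Homotopic u v p q) :
    X.Homotopic x y (r ++ p ++ s) (r ++ q ++ s) := by
  induction h with
  | refl p => exact .refl _
  | symm _ ih => exact ih.symm
  | trans _ _ ih₁ ih₂ => exact ih₁.trans ih₂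
  | backtrack a b e ha hb =>
    have := Homotopic.backtrack (r ++ a) (b ++ s) e (hr.append ha) (hb.append hs)
    simpa only [List.append_assoc] using this
  | face a b f ha hb =>
    have := Homotopic.face (r ++ a) (b ++ s) f (hr.append ha) (hb.append hs)
    simpa only [List.append_assoc] using this

end TwoComplex

section CayleyComplex

variable {α : Type} {rels : Set (List (α × Bool))}

theorem wordElt_append (v w : List (α × Bool)) :
    wordElt rels (v ++ w) = wordElt rels v * wordElt rels w := by
  simp only [wordElt, ← map_mul, FreeGroup.mul_mk]

theorem cayleyPath_append (v w : List (α × Bool)) (g : PresGroup rels) :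
    cayleyPath rels g (v ++ w) = cayleyPath rels g v ++ cayleyPath rels (g * wordElt rels v) w := by
  induction v generalizing g with
  | nil => simp [cayleyPath, wordElt_nil]
  | cons x v ih =>
    rw [List.cons_append, cayleyPath, ih, cayleyPath, mul_assoc, ← wordElt_cons, List.cons_append]

theorem isPath_cayleyPath (w : List (α × Bool)) (g : PresGroup rels) :
    (cayleyComplex rels).IsPath g (cayleyPath rels g w) (g * wordElt rels w) :=
  isEdgePath_cayleyPath rels w g

theorem eq_cayleyPath_of_isPath (p : List (cayleyComplex rels).E) (g h : PresGroup rels)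
    (hp : (cayleyComplex rels).IsPath g p h) : ∃ w, p = cayleyPath rels g w ∧
      h = g * wordElt rels w := by
  induction p generalizing g with
  | nil =>
    obtain rfl : g = h := hp
    exact ⟨[], rfl, by simp [wordElt_nil]⟩
  | cons e p ih =>
    obtain ⟨k, x⟩ := e
    obtain ⟨hk, hp⟩ := hp
    obtain rfl : k = g := hk
    obtain ⟨w, rfl, rfl⟩ := ih (k * wordElt rels [x]) hp
    exact ⟨x :: w, rfl, by rw [wordElt_cons rels x w, ← mul_assoc]⟩

/-- Two words are equivalent if they spell homotopic paths from every vertex of the Cayley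
complex. -/
def WordHomotopic (rels : Set (List (α × Bool))) (v w : List (α × Bool)) : Prop :=
  wordElt rels v = wordElt rels w ∧ ∀ g : PresGroup rels,
    (cayleyComplex rels).Homotopic g (g * wordElt rels v) (cayleyPath rels g v)
      (cayleyPath rels g w)

namespace WordHomotopic

theorem refl (w : List (α × Bool)) : WordHomotopic rels w w := ⟨rfl, fun _ => .refl _⟩

theorem symm {v w : List (α × Bool)} (h : WordHomotopic rels v w) : WordHomotopic rels w v :=
  ⟨h.1.symm, fun g => h.1 ▸ (h.2 g).symm⟩

theorem trans {u v w : List (α × Bool)} (h : WordHomotopic rels u v)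
    (h' : WordHomotopic rels v w) : WordHomotopic rels u w :=
  ⟨h.1.trans h'.1, fun g => (h.2 g).trans (h.1 ▸ h'.2 g)⟩

theorem append_append {v w : List (α × Bool)} (h : WordHomotopic rels v w)
    (a b : List (α × Bool)) : WordHomotopic rels (a ++ v ++ b) (a ++ w ++ b) := by
  refine ⟨by simp only [wordElt_append, h.1], fun g => ?_⟩
  simp only [cayleyPath_append, wordElt_append, ← mul_assoc]
  have h2 := h.2 (g * wordElt rels a)
  have := TwoComplex.Homotopic.append_append (isPath_cayleyPath a g)
    (isPath_cayleyPath b (g * wordElt rels a * wordElt rels v)) h2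
  rw [← h.1]
  exact this

theorem of_rel {w : List (α × Bool)} (hw : w ∈ rels) : WordHomotopic rels w [] := by
  refine ⟨by rw [wordElt_rel rels hw, wordElt_nil], fun g => ?_⟩
  rw [wordElt_rel rels hw, mul_one]
  have := TwoComplex.Homotopic.face (X := cayleyComplex rels) (x := g) (y := g) [] []
    (g, ⟨w, hw⟩) rfl rfl
  rw [List.append_nil, List.nil_append] at this
  exact this

theorem of_step {v w : List (α × Bool)} (h : FreeGroup.Red.Step v w) :
    WordHomotopic rels v w := by
  obtain @⟨L₁, L₂, a, b⟩ := h
  have key : WordHomotopic rels [(a, b), (a, !b)] [] := by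
    have h1 : wordElt rels [(a, b), (a, !b)] = 1 := by
      rw [wordElt_cons, wordElt_flip, mul_inv_cancel]
    refine ⟨by rw [h1, wordElt_nil], fun g => ?_⟩
    rw [h1, mul_one]
    have := TwoComplex.Homotopic.backtrack (X := cayleyComplex rels) (x := g) (y := g) [] []
      (g, (a, b)) rfl rfl
    exact this
  simpa using key.append_append L₁ L₂

/-- Words equal in the free group have a common reduction, and each reduction step deletes a
backtrack. -/
theorem of_mk_eq {v w : List (α × Bool)} (h : FreeGroup.mk v = FreeGroup.mk w) :
    WordHomotopic rels v w := by
  have red : ∀ {u u' : List (α × Bool)}, FreeGroup.Red u u' → WordHomotopic rels u u' := by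
    intro u u' h
    induction h with
    | refl => exact .refl _
    | tail _ h ih => exact ih.trans (.of_step h)
  obtain ⟨u, hv, hw⟩ := FreeGroup.Red.exact.1 h
  exact (red hv).trans (red hw).symm

end WordHomotopic

/-- The normal subgroup of the words that spell null-homotopic loops. -/
def nullHomotopicWords (rels : Set (List (α × Bool))) : Subgroup (FreeGroup α) where
  carrier := {g | ∀ w, FreeGroup.mk w = g → WordHomotopic rels w []}
  one_mem' := fun _ hw => .of_mk_eq hw
  mul_mem' := by
    intro a b ha hb w hw
    obtain ⟨u, rfl⟩ := Quot.exists_rep a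
    obtain ⟨v, rfl⟩ := Quot.exists_rep b
    have h1 : WordHomotopic rels w (u ++ v) := .of_mk_eq hw
    have h2 := (ha u rfl).append_append [] v
    exact h1.trans (h2.trans (hb v rfl))
  inv_mem' := by
    intro a ha w hw
    obtain ⟨u, rfl⟩ := Quot.exists_rep a
    have h1 : FreeGroup.mk (u ++ w) = FreeGroup.mk [] := by
      rw [← FreeGroup.mul_mk, hw, ← FreeGroup.one_eq_mk]
      exact mul_inv_cancel _
    have h2 := (ha u rfl).append_append [] w
    exact h2.symm.trans (.of_mk_eq h1)

instance (rels : Set (List (α × Bool))) : (nullHomotopicWords rels).Normal where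
  conj_mem := by
    intro a ha g w hw
    obtain ⟨u, rfl⟩ := Quot.exists_rep a
    obtain ⟨v, rfl⟩ := Quot.exists_rep g
    have h1 : WordHomotopic rels w (v ++ u ++ FreeGroup.invRev v) := .of_mk_eq (by
      rw [hw, ← FreeGroup.mul_mk, ← FreeGroup.mul_mk, ← FreeGroup.inv_mk]
      rfl)
    refine h1.trans (((ha u rfl).append_append v _).trans (.of_mk_eq ?_))
    rw [List.append_nil, ← FreeGroup.mul_mk, ← FreeGroup.inv_mk, mul_inv_cancel,
      FreeGroup.one_eq_mk]

/-- A word that is trivial in the presented group lies in the normal closure of the relators. That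
closure is contained in `nullHomotopicWords`, since each relator bounds a 2-cell at every vertex. -/
theorem WordHomotopic.of_wordElt_eq_one {w : List (α × Bool)} (hw : wordElt rels w = 1) :
    WordHomotopic rels w [] := by
  have h : FreeGroup.mk w ∈ Subgroup.normalClosure (FreeGroup.mk '' rels) :=
    (QuotientGroup.eq_one_iff _).1 hw
  have hle : Subgroup.normalClosure (FreeGroup.mk '' rels) ≤ nullHomotopicWords rels := by
    refine Subgroup.normalClosure_le_normal ?_
    rintro _ ⟨r, hr, rfl⟩ v hv
    exact (WordHomotopic.of_mk_eq hv).trans (.of_rel hr)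
  exact hle h w rfl

theorem exists_wordElt_eq (g : PresGroup rels) : ∃ w, wordElt rels w = g := by
  obtain ⟨x, rfl⟩ := PresentedGroup.mk_surjective _ g
  obtain ⟨w, rfl⟩ := Quot.exists_rep x
  exact ⟨w, rfl⟩

theorem isSimplyConnected_cayleyComplex (rels : Set (List (α × Bool))) :
    (cayleyComplex rels).IsSimplyConnected := by
  refine ⟨⟨(1 : PresGroup rels)⟩, ?_, ?_⟩
  · intro (g : PresGroup rels) (h : PresGroup rels)
    obtain ⟨w, hw⟩ := exists_wordElt_eq (g⁻¹ * h)
    refine ⟨cayleyPath rels g w, ?_⟩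
    have := isPath_cayleyPath w g
    rwa [hw, mul_inv_cancel_left] at this
  · intro (g : PresGroup rels) p hp
    obtain ⟨w, rfl, hw⟩ := eq_cayleyPath_of_isPath p g g hp
    have hw1 : wordElt rels w = 1 := mul_eq_left.1 hw.symm
    have := (WordHomotopic.of_wordElt_eq_one hw1).2 g
    rwa [hw1, mul_one] at this

/-- The Cayley 2-complex is the universal cover of the presentation complex. -/
theorem isUniversalCover_cayleyProjection (rels : Set (List (α × Bool))) :
    (cayleyProjection rels).IsUniversalCover := by
  refine ⟨⟨fun _ => ⟨(1 : PresGroup rels), rfl⟩, ?_, ?_⟩, isSimplyConnected_cayleyComplex rels⟩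
  · rintro g e -
    refine ⟨(g, e), ⟨rfl, rfl⟩, ?_⟩
    rintro ⟨g', e'⟩ ⟨rfl, rfl⟩
    rfl
  · rintro g f -
    refine ⟨(g, f), ⟨rfl, rfl⟩, ?_⟩
    rintro ⟨g', f'⟩ ⟨rfl, rfl⟩
    rfl

end CayleyComplex

/-! ### Distances in trees, and the height as a Busemann function. -/

section TreeDist

variable {V : Type*} {T : SimpleGraph V}

/-- Both neighbours start a shortest path from v to w, and a tree has only one path between two
vertices. -/
theorem SimpleGraph.IsTree.eq_of_adj_of_dist (hT : T.IsTree) {v w a b : V} (ha : T.Adj v a)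
    (hb : T.Adj v b) (hda : T.dist a w + 1 = T.dist v w) (hdb : T.dist b w + 1 = T.dist v w) :
    a = b := by
  obtain ⟨p, hp⟩ := hT.connected.exists_walk_length_eq_dist a w
  obtain ⟨q, hq⟩ := hT.connected.exists_walk_length_eq_dist b w
  have hp' : (SimpleGraph.Walk.cons ha p).IsPath :=
    SimpleGraph.Walk.isPath_of_length_eq_dist _ (by simp [hp, hda])
  have hq' : (SimpleGraph.Walk.cons hb q).IsPath :=
    SimpleGraph.Walk.isPath_of_length_eq_dist _ (by simp [hq, hdb])
  have h := congrArg (fun r => r.1.snd)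
    ((hT.isAcyclic.subsingleton_path v w).elim ⟨_, hp'⟩ ⟨_, hq'⟩)
  simpa using h

theorem SimpleGraph.Connected.exists_adj_dist_add_one (hT : T.Connected) {v w : V} (h : v ≠ w) :
    ∃ a, T.Adj v a ∧ T.dist a w + 1 = T.dist v w := by
  obtain ⟨p, hp⟩ := hT.exists_walk_length_eq_dist v w
  cases p with
  | nil => exact absurd rfl h
  | @cons _ a _ ha q =>
    refine ⟨a, ha, ?_⟩
    have h1 := T.dist_le q
    have h2 : T.dist v w ≤ T.dist v a + T.dist a w := hT.dist_triangle
    have h3 : T.dist v a = 1 := SimpleGraph.dist_eq_one_iff_adj.2 ha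
    rw [SimpleGraph.Walk.length_cons] at hp
    omega

end TreeDist

section Busemann

variable {V : Type*} {T : SimpleGraph V} {ρ : ℤ → V}

theorem IsGeodesicLine.adj (hρ : IsGeodesicLine T ρ) (j : ℤ) : T.Adj (ρ j) (ρ (j + 1)) := by
  rw [← SimpleGraph.dist_eq_one_iff_adj]
  have := hρ j (j + 1)
  rw [show j - (j + 1) = -1 by ring, abs_neg, abs_one] at this
  exact_mod_cast this

theorem IsGeodesicLine.injective (hρ : IsGeodesicLine T ρ) : Function.Injective ρ := by
  intro i j h
  have := hρ i j
  rw [h, SimpleGraph.dist_self, Nat.cast_zero, eq_comm, abs_eq_zero] at this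
  omega

/-- At a local maximum of the distance to v, the two neighbours on the line would both be nearer to
v, hence equal. -/
theorem IsGeodesicLine.no_peak (hT : T.IsTree) (hρ : IsGeodesicLine T ρ) (v : V) (i j k : ℤ)
    (hij : j = i + 1) (hjk : k = j + 1) (hi : T.dist v (ρ i) + 1 = T.dist v (ρ j)) :
    T.dist v (ρ k) + 1 ≠ T.dist v (ρ j) := by
  subst hij hjk
  intro hk
  rw [T.dist_comm (u := v), T.dist_comm (u := v)] at hi hk
  have := hρ.injective (hT.eq_of_adj_of_dist (hρ.adj i).symm (hρ.adj (i + 1)) hi hk)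
  omega

/-- Along the line the distance to v changes by exactly one at each step. It must increase on both
sides of a minimum, and without peaks it can never decrease again. -/
theorem IsGeodesicLine.dist_argmin (hT : T.IsTree) (hρ : IsGeodesicLine T ρ) (v : V) (j : ℤ) :
    (T.dist v (ρ j) : ℤ) = T.dist v (ρ (Function.argmin fun k : ℤ => T.dist v (ρ k))) +
      |j - Function.argmin fun k : ℤ => T.dist v (ρ k)| := by
  have hmin : ∀ i, T.dist v (ρ (Function.argmin fun k : ℤ => T.dist v (ρ k))) ≤ T.dist v (ρ i) :=
    fun i => Function.argmin_le (fun k : ℤ => T.dist v (ρ k)) i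
  generalize (Function.argmin fun k : ℤ => T.dist v (ρ k)) = m at *
  have hadj := fun j => hT.dist_eq_dist_add_one_of_adj v (hρ.adj j)
  have hup : ∀ n : ℕ, T.dist v (ρ (m + n)) + 1 = T.dist v (ρ (m + n + 1)) := by
    intro n
    induction n with
    | zero =>
      have h1 := hadj m
      have h2 := hmin (m + 1)
      simp only [Nat.cast_zero, add_zero] at *
      omega
    | succ n ih =>
      have h1 := hadj (m + n + 1)
      have h2 := hρ.no_peak hT v (m + n) (m + n + 1) (m + n + 1 + 1) rfl rfl ih
      rw [Nat.cast_succ, ← add_assoc]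
      omega
  have hdown : ∀ n : ℕ, T.dist v (ρ (m - n)) + 1 = T.dist v (ρ (m - n - 1)) := by
    intro n
    induction n with
    | zero =>
      have h1 := hadj (m - 1)
      have h2 := hmin (m - 1)
      simp only [Nat.cast_zero, sub_zero, sub_add_cancel] at *
      omega
    | succ n ih =>
      have h1 := hadj (m - n - 1 - 1)
      have h2 := hρ.no_peak hT v (m - n - 1 - 1) (m - n - 1) (m - n) (by ring) (by ring)
      rw [Nat.cast_succ, ← sub_sub]
      rw [sub_add_cancel] at h1
      omega
  have key : ∀ n : ℕ, (T.dist v (ρ (m + n)) : ℤ) = T.dist v (ρ m) + n ∧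
      (T.dist v (ρ (m - n)) : ℤ) = T.dist v (ρ m) + n := by
    intro n
    induction n with
    | zero => simp
    | succ n ih =>
      have h1 := hup n
      have h2 := hdown n
      rw [Nat.cast_succ, ← add_assoc, ← sub_sub]
      omega
  rcases le_total m j with h | h
  · have := (key (j - m).toNat).1
    rw [Int.toNat_of_nonneg (by omega), add_sub_cancel] at this
    rw [this, abs_of_nonneg (by omega)]
  · have := (key (m - j).toNat).2
    rw [Int.toNat_of_nonneg (by omega), sub_sub_cancel] at this
    rw [this, abs_of_nonpos (by omega), neg_sub]

theorem vertexHeight_le (hT : T.IsTree) (hρ : IsGeodesicLine T ρ) (v : V) (j : ℤ) :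
    vertexHeight T ρ v ≤ T.dist v (ρ j) + j := by
  have h1 := hρ.dist_argmin hT v j
  have h2 := neg_abs_le (j - Function.argmin fun k : ℤ => T.dist v (ρ k))
  unfold vertexHeight
  omega

/-- The height is the Busemann function of the end ρ(-∞): d(v, ρ j) + j is constant once j is below
the projection of v to the line. Comparing several vertices at one sufficiently low j turns
statements about heights into statements about distances. -/
theorem exists_vertexHeight_eq (hT : T.IsTree) (hρ : IsGeodesicLine T ρ) (v : V) :
    ∃ m, ∀ j ≤ m, vertexHeight T ρ v = T.dist v (ρ j) + j := by
  refine ⟨Function.argmin fun k : ℤ => T.dist v (ρ k), fun j hj => ?_⟩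
  have h1 := hρ.dist_argmin hT v j
  rw [abs_of_nonpos (by omega)] at h1
  unfold vertexHeight
  omega

theorem vertexHeight_line (hT : T.IsTree) (hρ : IsGeodesicLine T ρ) (k : ℤ) :
    vertexHeight T ρ (ρ k) = k := by
  obtain ⟨m, hm⟩ := exists_vertexHeight_eq hT hρ (ρ k)
  rw [hm (min m k) (min_le_left _ _), hρ, abs_of_nonneg (by omega)]
  omega

theorem vertexHeight_adj (hT : T.IsTree) (hρ : IsGeodesicLine T ρ) {u v : V} (h : T.Adj u v) :
    vertexHeight T ρ u = vertexHeight T ρ v + 1 ∨ vertexHeight T ρ v = vertexHeight T ρ u + 1 := by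
  obtain ⟨m, hm⟩ := exists_vertexHeight_eq hT hρ u
  obtain ⟨n, hn⟩ := exists_vertexHeight_eq hT hρ v
  have h1 := hm (min m n) (min_le_left _ _)
  have h2 := hn (min m n) (min_le_right _ _)
  have h3 := hT.dist_eq_dist_add_one_of_adj (ρ (min m n)) h
  rw [T.dist_comm (v := u), T.dist_comm (v := v)] at h3
  omega

theorem vertexHeight_descend (hT : T.IsTree) (hρ : IsGeodesicLine T ρ) {v : V} {j : ℤ}
    (hv : vertexHeight T ρ v = T.dist v (ρ j) + j) (hne : v ≠ ρ j) :
    ∃ u, T.Adj v u ∧ vertexHeight T ρ u = vertexHeight T ρ v - 1 ∧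
      T.dist u (ρ j) + 1 = T.dist v (ρ j) := by
  obtain ⟨u, hu, hd⟩ := hT.connected.exists_adj_dist_add_one hne
  refine ⟨u, hu, ?_, hd⟩
  have h1 := vertexHeight_le hT hρ u j
  have h2 := vertexHeight_adj hT hρ hu
  omega

theorem existsUnique_lower (hT : T.IsTree) (hρ : IsGeodesicLine T ρ) (v : V) :
    ∃! u, T.Adj v u ∧ vertexHeight T ρ u = vertexHeight T ρ v - 1 := by
  obtain ⟨m, hm⟩ := exists_vertexHeight_eq hT hρ v
  refine existsUnique_of_exists_of_unique ?_ ?_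
  · have hj : ∃ j ≤ m, v ≠ ρ j := by
      by_cases h : v = ρ m
      · refine ⟨m - 1, by omega, fun h' => ?_⟩
        have := hρ.injective (h.symm.trans h')
        omega
      · exact ⟨m, le_rfl, h⟩
    obtain ⟨j, hj, hne⟩ := hj
    obtain ⟨u, hu, hh, -⟩ := vertexHeight_descend hT hρ (hm j hj) hne
    exact ⟨u, hu, hh⟩
  · rintro a b ⟨ha, hha⟩ ⟨hb, hhb⟩
    obtain ⟨k, hk⟩ := exists_vertexHeight_eq hT hρ a
    obtain ⟨l, hl⟩ := exists_vertexHeight_eq hT hρ b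
    -- At a point of the line low enough for all three vertices, both a and b are one step nearer to
    -- it than v.
    have h1 := hm (min m (min k l)) (by omega)
    have h2 := hk (min m (min k l)) (by omega)
    have h3 := hl (min m (min k l)) (by omega)
    exact hT.eq_of_adj_of_dist (w := ρ (min m (min k l))) ha hb (by omega) (by omega)

/-- The neighbour of `v` that is one step closer to the end `ρ (-∞)`. -/
noncomputable def treeParent (T : SimpleGraph V) (ρ : ℤ → V) (v : V) : V :=
  haveI : Nonempty V := ⟨v⟩
  Classical.epsilon fun u => T.Adj v u ∧ vertexHeight T ρ u = vertexHeight T ρ v - 1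

theorem treeParent_spec (hT : T.IsTree) (hρ : IsGeodesicLine T ρ) (v : V) :
    T.Adj v (treeParent T ρ v) ∧
      vertexHeight T ρ (treeParent T ρ v) = vertexHeight T ρ v - 1 :=
  haveI : Nonempty V := ⟨v⟩
  Classical.epsilon_spec (existsUnique_lower hT hρ v).exists

theorem treeParent_eq (hT : T.IsTree) (hρ : IsGeodesicLine T ρ) {u v : V} (h : T.Adj v u)
    (hh : vertexHeight T ρ u = vertexHeight T ρ v - 1) : treeParent T ρ v = u :=
  (existsUnique_lower hT hρ v).unique (treeParent_spec hT hρ v) ⟨h, hh⟩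

theorem adj_iff_treeParent (hT : T.IsTree) (hρ : IsGeodesicLine T ρ) (u v : V) :
    T.Adj u v ↔ treeParent T ρ u = v ∨ treeParent T ρ v = u := by
  constructor
  · intro h
    rcases vertexHeight_adj hT hρ h with h' | h'
    · exact .inl (treeParent_eq hT hρ h (by omega))
    · exact .inr (treeParent_eq hT hρ h.symm (by omega))
  · rintro (rfl | rfl)
    · exact (treeParent_spec hT hρ u).1
    · exact (treeParent_spec hT hρ v).1.symm

theorem treeParent_line (hT : T.IsTree) (hρ : IsGeodesicLine T ρ) (k : ℤ) :
    treeParent T ρ (ρ (k + 1)) = ρ k :=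
  treeParent_eq hT hρ (hρ.adj k).symm
    (by rw [vertexHeight_line hT hρ, vertexHeight_line hT hρ]; ring)

theorem exists_iterate_treeParent (hT : T.IsTree) (hρ : IsGeodesicLine T ρ) (v : V) :
    ∃ (d : ℕ) (j : ℤ), (treeParent T ρ)^[d] v = ρ j := by
  obtain ⟨j, hj⟩ := exists_vertexHeight_eq hT hρ v
  replace hj := hj j le_rfl
  suffices ∀ (d : ℕ) (v : V), vertexHeight T ρ v = T.dist v (ρ j) + j → T.dist v (ρ j) = d →
      (treeParent T ρ)^[d] v = ρ j from ⟨_, j, this _ v hj rfl⟩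
  intro d
  induction d with
  | zero => exact fun v _ h => hT.connected.dist_eq_zero_iff.1 h
  | succ d ih =>
    intro v hv hd
    have hne : v ≠ ρ j := by
      rintro rfl
      simp at hd
    obtain ⟨u, hu, hh, hdu⟩ := vertexHeight_descend hT hρ hv hne
    rw [Function.iterate_succ_apply, treeParent_eq hT hρ hu hh]
    exact ih u (by omega) (by omega)

end Busemann

/-! ### Laurent series as coordinates on the tree. -/

section Labels

variable {V : Type*} {T : SimpleGraph V} {ρ : ℤ → V}

/-- Removing the parent from a countably infinite set of neighbours leaves a countably infinite set
of children, so they can be labelled by ℤ. At a vertex of the line, the label 0 is reserved for the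
next vertex of the line, so that vanishing low-order coefficients mean staying on it. -/
theorem exists_child_labels (hT : IsBranchingTree ℤ T) (hρ : IsGeodesicLine T ρ) (v : V) :
    ∃ c : ℤ → V, Function.Injective c ∧ (∀ w, treeParent T ρ w = v ↔ ∃ l, c l = w) ∧
      ∀ k, ρ k = v → c 0 = ρ (k + 1) := by
  obtain ⟨e⟩ := hT.2 v
  have hset : T.neighborSet v \ {treeParent T ρ v} = {w | treeParent T ρ w = v} := by
    ext w
    simp only [Set.mem_sdiff, SimpleGraph.mem_neighborSet, Set.mem_singleton_iff, Set.mem_ofPred_eq,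
      adj_iff_treeParent hT.1 hρ]
    constructor
    · rintro ⟨rfl | h, h'⟩
      · exact absurd rfl h'
      · exact h
    · intro h
      refine ⟨.inr h, ?_⟩
      rintro rfl
      have h1 := (treeParent_spec hT.1 hρ v).2
      have h2 := (treeParent_spec hT.1 hρ (treeParent T ρ v)).2
      rw [h] at h2
      omega
  have : Countable (T.neighborSet v) := e.injective.countable
  have : Infinite (T.neighborSet v) := Infinite.of_injective _ e.symm.injective
  have hinf : {w | treeParent T ρ w = v}.Infinite :=
    hset ▸ (Set.infinite_coe_iff.1 this).sdiff (Set.finite_singleton _)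
  have hcount : {w | treeParent T ρ w = v}.Countable :=
    hset ▸ (Set.countable_coe_iff.1 ‹_›).mono Set.sdiff_subset
  have := hinf.to_subtype
  have := hcount.to_subtype
  obtain ⟨c⟩ := nonempty_equiv_of_countable (α := ℤ) (β := {w | treeParent T ρ w = v})
  have hc : ∀ c : ℤ ≃ {w | treeParent T ρ w = v}, ∀ w, treeParent T ρ w = v ↔
      ∃ l, (c l : V) = w := by
    intro c w
    constructor
    · intro h
      exact ⟨c.symm ⟨w, h⟩, by simp⟩
    · rintro ⟨l, rfl⟩
      exact (c l).2
  by_cases hv : ∃ k, ρ k = v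
  · obtain ⟨k, hk⟩ := hv
    have hk' : treeParent T ρ (ρ (k + 1)) = v := by rw [treeParent_line hT.1 hρ, hk]
    -- A transposition moves the label 0 to the child on the line.
    let c' := (Equiv.swap 0 (c.symm ⟨ρ (k + 1), hk'⟩)).trans c
    refine ⟨fun l => c' l, Subtype.val_injective.comp c'.injective, hc c', fun j hj => ?_⟩
    obtain rfl := hρ.injective (hj.trans hk.symm)
    simp [c']
  · exact ⟨fun l => c l, Subtype.val_injective.comp c.injective, hc c,
      fun k hk => absurd ⟨k, hk⟩ hv⟩

/-- Coordinates on a branching tree: the vertices of height `n` are the Laurent series with integer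
coefficients, up to their terms of degree at least `n`. -/
structure TreeCoordinates (T : SimpleGraph V) (ρ : ℤ → V) where
  node : ℤ → LaurentSeries ℤ → V
  height_node : ∀ n a, vertexHeight T ρ (node n a) = n
  node_eq_iff : ∀ n a b, node n a = node n b ↔ ∀ k < n, a.coeff k = b.coeff k
  parent_node : ∀ n a, treeParent T ρ (node (n + 1) a) = node n a
  exists_node : ∀ v, ∃ a, node (vertexHeight T ρ v) a = v

/-- A series gives directions: leave the line at or below its order and use the coefficient of
degree k to choose the child at height k. Starting lower gives the same vertex, since the extra
coefficients are 0 and follow the line. Conversely, each vertex has an ancestor on the line, so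
finitely many coefficients reach it. -/
theorem exists_treeCoordinates (hT : IsBranchingTree ℤ T) (hρ : IsGeodesicLine T ρ) :
    Nonempty (TreeCoordinates T ρ) := by
  choose child hinj hchild hline using exists_child_labels hT hρ
  let climb : LaurentSeries ℤ → ℤ → ℕ → V :=
    fun a m j => Nat.rec (ρ m) (fun j v => child v (a.coeff (m + j))) j
  have climb_zero : ∀ a m, climb a m 0 = ρ m := fun _ _ => rfl
  have climb_succ : ∀ a m j, climb a m (j + 1) = child (climb a m j) (a.coeff (m + j)) :=
    fun _ _ _ => rfl
  have climb_line : ∀ (a : LaurentSeries ℤ) (m : ℤ) (d : ℕ), (∀ k < m + d, a.coeff k = 0) →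
      climb a m d = ρ (m + d) := by
    intro a m d
    induction d with
    | zero => intro _; simp [climb_zero]
    | succ d ih =>
      intro h
      rw [climb_succ, ih (fun k hk => h k (by push_cast; omega)), h _ (by push_cast; omega),
        hline _ _ rfl]
      push_cast
      rw [add_assoc]
  have climb_shift : ∀ (a : LaurentSeries ℤ) (m : ℤ) (d j : ℕ), (∀ k < m + d, a.coeff k = 0) →
      climb a m (d + j) = climb a (m + d) j := by
    intro a m d j h
    induction j with
    | zero => rw [add_zero, climb_line a m d h, climb_zero]
    | succ j ih => rw [← add_assoc, climb_succ, climb_succ, ih]; push_cast; rw [add_assoc]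
  let node : ℤ → LaurentSeries ℤ → V :=
    fun n a => climb a (min n a.order) (n - min n a.order).toNat
  have node_eq : ∀ (n : ℤ) (a : LaurentSeries ℤ) (m : ℤ), m ≤ n → m ≤ a.order →
      node n a = climb a m (n - m).toNat := by
    intro n a m hn ha
    have h := climb_shift a m (min n a.order - m).toNat (n - min n a.order).toNat
      (fun k hk => HahnSeries.coeff_eq_zero_of_lt_order (by omega))
    rw [show (min n a.order - m).toNat + (n - min n a.order).toNat = (n - m).toNat by omega,
      show m + ((min n a.order - m).toNat : ℤ) = min n a.order by omega] at h
    exact h.symm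
  have node_line : ∀ (a : LaurentSeries ℤ) (m : ℤ), m ≤ a.order → node m a = ρ m := by
    intro a m hm
    rw [node_eq m a m le_rfl hm, sub_self]
    rfl
  have node_succ : ∀ (n : ℤ) (a : LaurentSeries ℤ),
      node (n + 1) a = child (node n a) (a.coeff n) := by
    intro n a
    rw [node_eq (n + 1) a (min n a.order) (by omega) (by omega),
      node_eq n a (min n a.order) (by omega) (by omega),
      show (n + 1 - min n a.order).toNat = (n - min n a.order).toNat + 1 by omega, climb_succ]
    congr 2
    omega
  have parent_child : ∀ v l, treeParent T ρ (child v l) = v :=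
    fun v l => (hchild v _).2 ⟨l, rfl⟩
  have child_inj : ∀ v w k l, child v k = child w l ↔ v = w ∧ k = l := by
    intro v w k l
    refine ⟨fun h => ?_, fun h => by rw [h.1, h.2]⟩
    have hvw : v = w := by rw [← parent_child v k, h, parent_child]
    subst hvw
    exact ⟨rfl, hinj v h⟩
  have parent_node : ∀ n a, treeParent T ρ (node (n + 1) a) = node n a := by
    intro n a
    rw [node_succ, parent_child]
  have node_eq_iff : ∀ n a b, node n a = node n b ↔ ∀ k < n, a.coeff k = b.coeff k := by
    intro n a b
    obtain ⟨m, hn, ha, hb⟩ : ∃ m : ℤ, m ≤ n ∧ m ≤ a.order ∧ m ≤ b.order :=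
      ⟨min n (min a.order b.order), by omega, by omega, by omega⟩
    induction n, hn using Int.leInduction with
    | base =>
      rw [node_line a m ha, node_line b m hb]
      refine ⟨fun _ k hk => ?_, fun _ => rfl⟩
      rw [HahnSeries.coeff_eq_zero_of_lt_order (by omega),
        HahnSeries.coeff_eq_zero_of_lt_order (by omega)]
    | succ n hn ih =>
      rw [node_succ, node_succ, child_inj, ih]
      constructor
      · rintro ⟨h1, h2⟩ k hk
        rcases eq_or_lt_of_le (Int.lt_add_one_iff.1 hk) with rfl | h
        · exact h2
        · exact h1 k h
      · exact fun h => ⟨fun k hk => h k (by omega), h n (by omega)⟩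
  have height_node : ∀ n a, vertexHeight T ρ (node n a) = n := by
    intro n a
    obtain ⟨m, hn, ha⟩ : ∃ m : ℤ, m ≤ n ∧ m ≤ a.order :=
      ⟨min n a.order, by omega, by omega⟩
    induction n, hn using Int.leInduction with
    | base => rw [node_line a m ha, vertexHeight_line hT.1 hρ]
    | succ n hn ih =>
      have := (treeParent_spec hT.1 hρ (node (n + 1) a)).2
      rw [parent_node, ih] at this
      omega
  refine ⟨⟨node, height_node, node_eq_iff, parent_node, ?_⟩⟩
  intro v
  obtain ⟨d, j, hd⟩ := exists_iterate_treeParent hT.1 hρ v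
  induction d generalizing v with
  | zero =>
    obtain rfl : v = ρ j := hd
    -- Any non-zero series of order above j represents ρ j. The zero series would not fit
    -- `node_line` for j > 0, because its order is 0 by convention.
    refine ⟨HahnSeries.single (j + 1) 1, ?_⟩
    rw [vertexHeight_line hT.1 hρ]
    apply node_line
    rw [HahnSeries.order_single one_ne_zero]
    omega
  | succ d ih =>
    rw [Function.iterate_succ_apply] at hd
    obtain ⟨a, ha⟩ := ih _ hd
    obtain ⟨l, hl⟩ := (hchild (treeParent T ρ v) v).1 rfl
    have hh := (treeParent_spec hT.1 hρ v).2
    rw [hh] at ha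
    generalize vertexHeight T ρ v = n at *
    obtain ⟨n, rfl⟩ : ∃ k, n = k + 1 := ⟨n - 1, by ring⟩
    rw [add_sub_cancel_right] at ha
    -- The series of the parent, with the coefficient of degree n replaced by the label of v.
    refine ⟨a + HahnSeries.single n (l - a.coeff n), ?_⟩
    have h1 : node n (a + HahnSeries.single n (l - a.coeff n)) = node n a := by
      rw [node_eq_iff]
      intro k hk
      rw [HahnSeries.coeff_add, HahnSeries.coeff_single_of_ne hk.ne, add_zero]
    rw [node_succ, h1, ha, HahnSeries.coeff_add, HahnSeries.coeff_single_same, add_sub_cancel, hl]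

end Labels

/-! ### Expansions at 0, -1 and ∞, and partial fractions. -/

section LaurentExpansions

theorem HahnSeries.order_eq_and_isUnit {a : LaurentSeries ℤ} {n : ℤ} (h : IsUnit (a.coeff n))
    (h0 : ∀ k < n, a.coeff k = 0) : a.order = n ∧ IsUnit a := by
  have hne : a ≠ 0 := by
    rintro rfl
    simp at h
  have ho : a.order = n := by
    apply le_antisymm
    · exact HahnSeries.order_le_of_coeff_ne_zero h.ne_zero
    · exact (HahnSeries.le_order_iff_forall hne).2 h0
  refine ⟨ho, ?_⟩
  rw [HahnSeries.isUnit_iff, HahnSeries.leadingCoeff_eq, ho]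
  exact h

theorem HahnSeries.coeff_mul_eq_zero {a b : LaurentSeries ℤ} {m n : ℤ}
    (ha : ∀ k < m, a.coeff k = 0) (hb : ∀ k < n, b.coeff k = 0) :
    ∀ k < m + n, (a * b).coeff k = 0 := by
  intro k hk
  by_cases ha0 : a = 0
  · simp [ha0]
  by_cases hb0 : b = 0
  · simp [hb0]
  apply HahnSeries.coeff_eq_zero_of_lt_order
  rw [HahnSeries.order_mul ha0 hb0]
  have h1 := (HahnSeries.le_order_iff_forall ha0).2 ha
  have h2 := (HahnSeries.le_order_iff_forall hb0).2 hb
  omega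

theorem LaurentSeries.coeff_intCast_mul (z : ℤ) (a : LaurentSeries ℤ) (k : ℤ) :
    ((z : LaurentSeries ℤ) * a).coeff k = z * a.coeff k := by
  let f : LaurentSeries ℤ →+ ℤ := ⟨⟨fun a => a.coeff k, HahnSeries.coeff_zero⟩,
    fun a b => HahnSeries.coeff_add⟩
  have h := map_zsmul f z a
  rwa [zsmul_eq_mul, smul_eq_mul] at h

theorem LaurentSeries.order_units_zpow (u : (LaurentSeries ℤ)ˣ) (n : ℤ) :
    ((u ^ n : (LaurentSeries ℤ)ˣ) : LaurentSeries ℤ).order = n * (u : LaurentSeries ℤ).order := by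
  let f : (LaurentSeries ℤ)ˣ →* Multiplicative ℤ :=
    MonoidHom.mk' (fun u => .ofAdd (u : LaurentSeries ℤ).order) (fun u v => by
      rw [Units.val_mul, HahnSeries.order_mul u.ne_zero v.ne_zero, ofAdd_add])
  have h := map_zpow f u n
  exact h

/-- The variable as a unit of the ring of Laurent series. -/
noncomputable def laurentVar (k : ℤ) : (LaurentSeries ℤ)ˣ where
  val := HahnSeries.single k 1
  inv := HahnSeries.single (-k) 1
  val_inv := by rw [HahnSeries.single_mul_single, add_neg_cancel, mul_one]; rfl
  inv_val := by rw [HahnSeries.single_mul_single, neg_add_cancel, mul_one]; rfl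

theorem laurentVar_one_zpow (k : ℤ) : laurentVar 1 ^ k = laurentVar k := by
  let f : Multiplicative ℤ →* (LaurentSeries ℤ)ˣ :=
    MonoidHom.mk' (fun k => laurentVar k.toAdd) (fun k l => by
      ext1
      simp [laurentVar])
  have h := map_zpow f (.ofAdd 1) k
  rw [← ofAdd_zsmul, smul_eq_mul, mul_one] at h
  exact h.symm

/-- The expansions of `x` at the three places `x = 0`, `x = -1`, `x = ∞`. -/
noncomputable def placeVar : Fin 3 → LaurentSeries ℤ :=
  ![HahnSeries.single 1 1, HahnSeries.single 1 1 - 1, HahnSeries.single (-1) 1]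

/-- The order of `x ^ h₀ (1 + x) ^ h₁` at the three places. -/
def placeWeight (i : Fin 3) (h : ℤ × ℤ) : ℤ := ![h.1, h.2, -(h.1 + h.2)] i

theorem placeWeight_eq (i : Fin 3) (h : ℤ × ℤ) :
    placeWeight i h = h.1 * placeWeight i (1, 0) + h.2 * placeWeight i (0, 1) := by
  fin_cases i <;> simp [placeWeight] ; ring

theorem placeWeight_add (i : Fin 3) (h k : ℤ × ℤ) :
    placeWeight i (h + k) = placeWeight i h + placeWeight i k := by
  fin_cases i <;> simp [placeWeight] ; ring

theorem placeWeight_neg (i : Fin 3) (h : ℤ × ℤ) : placeWeight i (-h) = -placeWeight i h := by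
  fin_cases i <;> simp [placeWeight] ; ring

theorem placeVar_order (i : Fin 3) :
    (placeVar i).order = placeWeight i (1, 0) ∧ IsUnit (placeVar i) := by
  apply HahnSeries.order_eq_and_isUnit
  · fin_cases i <;> simp [placeVar, placeWeight]
  · intro k hk
    fin_cases i <;> simp [placeVar, placeWeight, HahnSeries.coeff_single, HahnSeries.coeff_one] at hk ⊢
      <;> grind

theorem one_add_placeVar_order (i : Fin 3) :
    (1 + placeVar i).order = placeWeight i (0, 1) ∧ IsUnit (1 + placeVar i) := by
  apply HahnSeries.order_eq_and_isUnit
  · fin_cases i <;> simp [placeVar, placeWeight, HahnSeries.coeff_one]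
  · intro k hk
    fin_cases i <;> simp [placeVar, placeWeight, HahnSeries.coeff_single, HahnSeries.coeff_one] at hk ⊢
      <;> grind

/-- The Laurent expansions of the elements of `ℤ[x, x⁻¹, (1+x)⁻¹]` at the three places. -/
noncomputable def expand (i : Fin 3) : LaurentRing →+* LaurentSeries ℤ :=
  IsLocalization.lift (M := Submonoid.closure ({Polynomial.X, 1 + Polynomial.X} : Set ℤ[X]))
    (g := (Polynomial.aeval (placeVar i) : ℤ[X] →ₐ[ℤ] LaurentSeries ℤ).toRingHom) (by
      rintro ⟨s, hs⟩
      obtain ⟨m, n, rfl⟩ := (Submonoid.mem_closure_pair _ _ _).1 hs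
      simpa using ((placeVar_order i).2.pow m).mul ((one_add_placeVar_order i).2.pow n))

theorem expand_algebraMap (i : Fin 3) (P : ℤ[X]) :
    expand i (algebraMap ℤ[X] LaurentRing P) = Polynomial.aeval (placeVar i) P :=
  IsLocalization.lift_eq _ _

theorem expand_unitX (i : Fin 3) : expand i unitX = placeVar i := by
  have h := expand_algebraMap i Polynomial.X
  rwa [Polynomial.aeval_X] at h

theorem expand_unitOneAddX (i : Fin 3) : expand i unitOneAddX = 1 + placeVar i := by
  have h := expand_algebraMap i (1 + Polynomial.X)
  rwa [map_add (Polynomial.aeval _), map_one (Polynomial.aeval _), Polynomial.aeval_X] at h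

/-- Orders are additive, and an invertible Laurent series over ℤ has leading coefficient ±1. This
unit leading coefficient is what lets integer multiples realize every label of a child. -/
theorem expand_actUnit_order (i : Fin 3) (h : ℤ × ℤ) :
    (expand i (actUnit h)).order = placeWeight i h ∧
      IsUnit ((expand i (actUnit h)).coeff (placeWeight i h)) := by
  have ho : (expand i (actUnit h)).order = placeWeight i h := by
    have e : expand i (actUnit h) = ((Units.map (expand i : LaurentRing →* LaurentSeries ℤ) unitX ^ h.1 *
        Units.map (expand i : LaurentRing →* LaurentSeries ℤ) unitOneAddX ^ h.2 :
        (LaurentSeries ℤ)ˣ) : LaurentSeries ℤ) := by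
      rw [← map_zpow, ← map_zpow, ← map_mul]
      rfl
    rw [e, Units.val_mul, HahnSeries.order_mul (Units.ne_zero _) (Units.ne_zero _),
      LaurentSeries.order_units_zpow, LaurentSeries.order_units_zpow, Units.coe_map, Units.coe_map,
      placeWeight_eq i h]
    have e1 := expand_unitX i
    have e2 := expand_unitOneAddX i
    simp only [MonoidHom.coe_coe]
    rw [e1, e2, (placeVar_order i).1, (one_add_placeVar_order i).1]
  refine ⟨ho, ?_⟩
  rw [← ho, ← HahnSeries.leadingCoeff_eq, ← HahnSeries.isUnit_iff]
  exact (actUnit h).isUnit.map (expand i)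

theorem coeff_expand_actUnit (i : Fin 3) (h : ℤ × ℤ) :
    ∀ k < placeWeight i h, (expand i (actUnit h)).coeff k = 0 := fun _ hk =>
  HahnSeries.coeff_eq_zero_of_lt_order (by rwa [(expand_actUnit_order i h).1])

theorem coeff_aeval_single {e : ℤ} (he : e ≠ 0) (P : ℤ[X]) (k : ℕ) :
    (Polynomial.aeval (HahnSeries.single e 1 : LaurentSeries ℤ) P).coeff (k * e) = P.coeff k := by
  induction P using Polynomial.induction_on' with
  | add P Q hP hQ => rw [map_add, HahnSeries.coeff_add, hP, hQ, Polynomial.coeff_add]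
  | monomial n z =>
    rw [Polynomial.aeval_monomial, HahnSeries.single_pow, Polynomial.coeff_monomial, one_pow,
      eq_intCast (algebraMap ℤ (LaurentSeries ℤ)), LaurentSeries.coeff_intCast_mul,
      HahnSeries.coeff_single, nsmul_eq_mul]
    simp only [mul_left_inj' he, Nat.cast_inj]
    grind

/-- The shift of the third expansion: only the functions of negative degree are integral at `∞`. -/
def placeShift : Fin 3 → ℤ := ![0, 0, 1]

theorem X_pow_dvd_of_expand {P : ℤ[X]} {m : ℕ}
    (h : ∀ k < (m : ℤ), (Polynomial.aeval (HahnSeries.single 1 1 : LaurentSeries ℤ) P).coeff k = 0) :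
    Polynomial.X ^ m ∣ P := by
  rw [Polynomial.X_pow_dvd_iff]
  intro d hd
  have := h d (by exact_mod_cast hd)
  rw [← coeff_aeval_single one_ne_zero, mul_one, this]

/-- Without poles at 0 and -1, d is a polynomial; vanishing at ∞ as well, it is 0. This is the
uniqueness half of partial fractions. -/
theorem eq_zero_of_expand {d : LaurentRing}
    (h : ∀ i, ∀ k < placeShift i, (expand i d).coeff k = 0) : d = 0 := by
  obtain ⟨m, n, P, hP⟩ := exists_eq_polynomial_mul_actUnit d
  have key : ∀ i, ∀ k < placeShift i + placeWeight i (m, n),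
      (Polynomial.aeval (placeVar i) P).coeff k = 0 := by
    intro i
    rw [← expand_algebraMap, ← hP, map_mul]
    exact HahnSeries.coeff_mul_eq_zero (h i) (coeff_expand_actUnit i _)
  have h0 : Polynomial.X ^ m ∣ P := X_pow_dvd_of_expand (by
    simpa [placeShift, placeWeight, placeVar] using key 0)
  have h1 : (1 + Polynomial.X) ^ n ∣ P := by
    -- The substitution x ↦ x - 1 moves the place -1 to 0.
    have h2 : Polynomial.X ^ n ∣ P.comp (Polynomial.X - 1) := X_pow_dvd_of_expand (by
      rw [Polynomial.aeval_comp]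
      simpa [placeShift, placeWeight, placeVar] using key 1)
    obtain ⟨Q, hQ⟩ := h2
    refine ⟨Q.comp (Polynomial.X + 1), ?_⟩
    have h3 := congrArg (fun R => R.comp (Polynomial.X + 1)) hQ
    simpa [Polynomial.comp_assoc, add_comm] using h3
  -- Over ℤ, coprimality comes from (1 + x) - x = 1; it is what allows both denominators to be
  -- cancelled at once.
  have hcop : IsCoprime ((Polynomial.X : ℤ[X]) ^ m) ((1 + Polynomial.X) ^ n) :=
    IsCoprime.pow ⟨-1, 1, by ring⟩
  obtain ⟨Q, rfl⟩ := hcop.mul_dvd h0 h1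
  have hd : d = algebraMap ℤ[X] _ Q := by
    rw [map_mul, ← actUnit_natCast, mul_comm] at hP
    exact (actUnit ((m : ℤ), (n : ℤ))).isUnit.mul_left_cancel hP
  have hQ : Q = 0 := by
    ext k
    -- At ∞ the coefficient of x^k has degree -k, and -k < 1 for every k ≥ 0. The shift 1 is needed
    -- to include the constant term.
    have h2 := h 2 (k * (-1)) (by simp [placeShift]; omega)
    rw [hd, expand_algebraMap] at h2
    have h3 := coeff_aeval_single (e := -1) (by norm_num) Q k
    rw [Polynomial.coeff_zero, ← h3]
    exact h2
  rw [hd, hQ, map_zero]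

/-- The exponents of the local parameters `x`, `1 + x` and `x⁻¹` at the three places. -/
def placeParam : Fin 3 → ℤ × ℤ := ![(1, 0), (0, 1), (-1, 0)]

theorem expand_placeParam (i : Fin 3) (k : ℤ) :
    expand i (actUnit (k • placeParam i)) = HahnSeries.single k 1 := by
  have h1 : Units.map (expand i : LaurentRing →* LaurentSeries ℤ) (actUnit (placeParam i)) =
      laurentVar 1 := by
    fin_cases i
    · ext1
      simpa [placeParam, actUnit, placeVar, laurentVar] using expand_unitX 0
    · ext1
      simpa [placeParam, actUnit, placeVar, laurentVar] using expand_unitOneAddX 1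
    · rw [← inv_inj, ← map_inv]
      ext1
      simpa [placeParam, actUnit, placeVar, laurentVar] using expand_unitX 2
  have h2 : actUnit (k • placeParam i) = actUnit (placeParam i) ^ k := by
    simp only [actUnit, mul_zpow, ← zpow_mul, Prod.smul_fst, Prod.smul_snd, smul_eq_mul, mul_comm]
  have h3 := congrArg (fun u : (LaurentSeries ℤ)ˣ => (u ^ k : (LaurentSeries ℤ)ˣ)) h1
  simp only [← map_zpow, ← h2, laurentVar_one_zpow] at h3
  exact congrArg Units.val h3

/-- The existence half of partial fractions: the required terms form a Laurent polynomial in the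
local parameter x, 1 + x or x⁻¹. The exponents that occur are negative at 0 and -1 and at most 0 at
∞, so these terms contribute nothing in the relevant degrees at the other two places. Assigning
constants to ∞ alone avoids counting them twice. -/
theorem exists_expand_at (i : Fin 3) (b : LaurentSeries ℤ) :
    ∃ f : LaurentRing, (∀ k < placeShift i, (expand i f).coeff k = b.coeff k) ∧
      ∀ j ≠ i, ∀ k < placeShift j, (expand j f).coeff k = 0 := by
  refine ⟨∑ l ∈ Finset.Ico b.order (placeShift i),
    (b.coeff l : LaurentRing) * actUnit (l • placeParam i), ?_, ?_⟩
  · intro k hk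
    rw [map_sum, HahnSeries.coeff_sum]
    simp only [map_mul, map_intCast, expand_placeParam, LaurentSeries.coeff_intCast_mul,
      HahnSeries.coeff_single]
    by_cases hb : b.order ≤ k
    · rw [Finset.sum_eq_single k]
      · simp
      · intro l _ hl
        rw [if_neg hl.symm, mul_zero]
      · exact fun h => absurd (Finset.mem_Ico.2 ⟨hb, hk⟩) h
    · rw [HahnSeries.coeff_eq_zero_of_lt_order (not_le.1 hb)]
      refine Finset.sum_eq_zero fun l hl => ?_
      rw [if_neg (by have := Finset.mem_Ico.1 hl; omega), mul_zero]
  · intro j hj k hk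
    rw [map_sum, HahnSeries.coeff_sum]
    refine Finset.sum_eq_zero fun l hl => ?_
    rw [map_mul, map_intCast, LaurentSeries.coeff_intCast_mul, coeff_expand_actUnit, mul_zero]
    have hl' := (Finset.mem_Ico.1 hl).2
    fin_cases i <;> fin_cases j <;>
      simp [placeShift, placeWeight, placeParam] at hj hk hl' ⊢ <;> omega

theorem exists_expand (b : Fin 3 → LaurentSeries ℤ) :
    ∃ f : LaurentRing, ∀ i, ∀ k < placeShift i, (expand i f).coeff k = (b i).coeff k := by
  choose f hf hf' using fun i => exists_expand_at i (b i)
  refine ⟨∑ i, f i, fun i k hk => ?_⟩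
  rw [map_sum, HahnSeries.coeff_sum, Finset.sum_eq_single i, hf i k hk]
  · exact fun j _ hj => hf' j i hj.symm k hk
  · simp

theorem exists_expand_shifted (h : ℤ × ℤ) (b : Fin 3 → LaurentSeries ℤ) :
    ∃ f : LaurentRing, ∀ i, ∀ k < placeWeight i h + placeShift i,
      (expand i f).coeff k = (b i).coeff k := by
  -- Multiplication by the unit with exponent h shifts the truncation degrees by its weights, which
  -- reduces the claim to the unshifted case.
  obtain ⟨f, hf⟩ := exists_expand (fun i => b i * expand i (actUnit (-h)))
  refine ⟨f * actUnit h, fun i k hk => ?_⟩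
  have h1 : (expand i (actUnit (-h))) * expand i (actUnit h) = 1 := by
    rw [← map_mul, ← Units.val_mul, ← actUnit_add, neg_add_cancel, actUnit_zero, Units.val_one,
      map_one]
  have h2 : expand i (f * actUnit h) - b i =
      (expand i f - b i * expand i (actUnit (-h))) * expand i (actUnit h) := by
    rw [map_mul, sub_mul, mul_assoc, h1, mul_one]
  have h3 := HahnSeries.coeff_mul_eq_zero (m := placeShift i)
    (a := expand i f - b i * expand i (actUnit (-h)))
    (fun k hk => by rw [HahnSeries.coeff_sub, hf i k hk, sub_self])
    (coeff_expand_actUnit i h) k (by omega)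
  rw [← h2, HahnSeries.coeff_sub, sub_eq_zero] at h3
  exact h3

end LaurentExpansions

/-! ### Elements of Γ₂ as triples of tree vertices. -/

section Positions

variable {V : Type*} {T : SimpleGraph V} {ρ : ℤ → V}

/-- The terms of the expansion of `f` that matter at the `i`-th place, shifted so that those
of degree less than `placeWeight i h` are seen by `(f, h)`. -/
noncomputable def placeSeries (i : Fin 3) (f : LaurentRing) : LaurentSeries ℤ :=
  HahnSeries.single (-placeShift i) 1 * expand i f

theorem coeff_placeSeries (i : Fin 3) (f : LaurentRing) (k : ℤ) :
    (placeSeries i f).coeff k = (expand i f).coeff (k + placeShift i) := by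
  have := HahnSeries.coeff_single_mul_add (r := (1 : ℤ)) (x := expand i f)
    (a := k + placeShift i) (b := -placeShift i)
  rw [one_mul, add_neg_cancel_right] at this
  exact this

/-- The `i`-th coordinate of the vertex of the horocyclic product that belongs to an element
of `Γ₂`. -/
noncomputable def TreeCoordinates.pos (C : TreeCoordinates T ρ) (i : Fin 3) (g : Gamma2) : V :=
  C.node (placeWeight i g.shift) (placeSeries i g.poly)

namespace TreeCoordinates

variable (C : TreeCoordinates T ρ)

theorem height_pos (i : Fin 3) (g : Gamma2) :
    vertexHeight T ρ (C.pos i g) = placeWeight i g.shift :=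
  C.height_node _ _

/-- The heights determine h. The difference of the polynomial components, divided by the unit of
exponent h, satisfies the conditions of `eq_zero_of_expand`. -/
theorem pos_injective {g g' : Gamma2} (h : ∀ i, C.pos i g = C.pos i g') : g = g' := by
  have hw : ∀ i, placeWeight i g.shift = placeWeight i g'.shift := by
    intro i
    rw [← C.height_pos, h, C.height_pos]
  have hs : g.shift = g'.shift := Prod.ext (hw 0) (hw 1)
  have hc : ∀ i, ∀ k < placeShift i + placeWeight i g.shift,
      (expand i (g.poly - g'.poly)).coeff k = 0 := by
    intro i k hk
    have h1 := h i
    rw [pos, pos, ← hw, C.node_eq_iff] at h1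
    have h2 := h1 (k - placeShift i) (by omega)
    rw [coeff_placeSeries, coeff_placeSeries, sub_add_cancel] at h2
    rw [map_sub, HahnSeries.coeff_sub, h2, sub_self]
  have h0 : (g.poly - g'.poly) * actUnit (-g.shift) = 0 := by
    refine eq_zero_of_expand fun i k hk => ?_
    rw [map_mul]
    refine HahnSeries.coeff_mul_eq_zero (hc i) (coeff_expand_actUnit i _) k ?_
    rw [placeWeight_neg]
    omega
  rw [Units.mul_left_eq_zero, sub_eq_zero] at h0
  exact Gamma2.ext h0 hs

theorem exists_pos_eq (v : Fin 3 → V) (hv : ∑ i, vertexHeight T ρ (v i) = 0) :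
    ∃ g, ∀ i, C.pos i g = v i := by
  choose a ha using fun i => C.exists_node (v i)
  let h : ℤ × ℤ := (vertexHeight T ρ (v 0), vertexHeight T ρ (v 1))
  have hw : ∀ i, placeWeight i h = vertexHeight T ρ (v i) := by
    rw [Fin.sum_univ_three] at hv
    intro i
    fin_cases i <;> simp [placeWeight, h]
    omega
  obtain ⟨f, hf⟩ := exists_expand_shifted h
    (fun i => HahnSeries.single (placeShift i) 1 * a i)
  refine ⟨⟨f, h⟩, fun i => ?_⟩
  rw [← ha i, pos, hw, C.node_eq_iff]
  intro k hk
  rw [coeff_placeSeries, hf i _ (by rw [hw]; omega), HahnSeries.coeff_single_mul_add, one_mul]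

theorem expand_add_mul_actUnit (i : Fin 3) (f : LaurentRing) (c : ℤ) (h : ℤ × ℤ) (k : ℤ) :
    (expand i (f + c * actUnit h)).coeff k =
      (expand i f).coeff k + c * (expand i (actUnit h)).coeff k := by
  rw [map_add, HahnSeries.coeff_add, map_mul, map_intCast, LaurentSeries.coeff_intCast_mul]

theorem node_add_mul_actUnit (i : Fin 3) (f : LaurentRing) (c : ℤ) (h : ℤ × ℤ) (n : ℤ)
    (hn : n + placeShift i ≤ placeWeight i h) :
    C.node n (placeSeries i (f + c * actUnit h)) = C.node n (placeSeries i f) := by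
  rw [C.node_eq_iff]
  intro k hk
  rw [coeff_placeSeries, coeff_placeSeries, expand_add_mul_actUnit,
    coeff_expand_actUnit i h _ (by omega), mul_zero, add_zero]

/-- The added unit has order exactly at the one new coefficient that distinguishes the children,
where its coefficient is ±1; so c can be solved for in ℤ. -/
theorem exists_node_add_mul_actUnit (hT : T.IsTree) (hρ : IsGeodesicLine T ρ) (i : Fin 3)
    (f : LaurentRing) (h : ℤ × ℤ) (n : ℤ) (hn : n + placeShift i = placeWeight i h) (w : V)
    (hw : treeParent T ρ w = C.node n (placeSeries i f)) :
    ∃ c : ℤ, C.node (n + 1) (placeSeries i (f + c * actUnit h)) = w := by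
  obtain ⟨a, ha⟩ := C.exists_node w
  have hh := (treeParent_spec hT hρ w).2
  rw [hw, C.height_node] at hh
  obtain rfl : w = C.node (n + 1) a := by
    rw [show n + 1 = vertexHeight T ρ w by omega, ha]
  rw [C.parent_node, C.node_eq_iff] at hw
  obtain ⟨ε, hε⟩ := (expand_actUnit_order i h).2
  refine ⟨(a.coeff n - (placeSeries i f).coeff n) * (ε⁻¹ : ℤˣ), ?_⟩
  rw [C.node_eq_iff]
  intro k hk
  rw [coeff_placeSeries, expand_add_mul_actUnit, ← coeff_placeSeries]
  rcases eq_or_lt_of_le (Int.lt_add_one_iff.1 hk) with rfl | hk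
  · rw [hn, ← hε, Units.inv_mul_cancel_right]
    ring
  · rw [coeff_expand_actUnit i h _ (by omega), mul_zero, add_zero, hw k hk]

end TreeCoordinates

end Positions

/-! ### How the generators move the three coordinates. -/

/-- The generators `λ_c`, `μ_c` and `ν_c`, for `t = 0, 1, 2`. -/
def Gen.ofIndex (t : Fin 3) (c : ℤ) : Gen := ![Gen.lam c, Gen.mu c, Gen.nu c] t

theorem Gen.exists_ofIndex (x : Gen) : ∃ t c, x = Gen.ofIndex t c := by
  rcases x with c | c | c
  · exact ⟨0, c, rfl⟩
  · exact ⟨1, c, rfl⟩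
  · exact ⟨2, c, rfl⟩

/-- The coordinate in which a generator goes up. -/
def genUp : Fin 3 → Fin 3 := ![0, 1, 0]

/-- The coordinate in which a generator goes down. -/
def genDown : Fin 3 → Fin 3 := ![2, 2, 1]

/-- The coordinate that a generator does not change. -/
def genStay : Fin 3 → Fin 3 := ![1, 0, 2]

/-- The `ℤ²`-component of a generator. -/
def genShift : Fin 3 → ℤ × ℤ := ![(1, 0), (0, 1), (1, -1)]

/-- The exponents of the unit in the polynomial component of a generator. -/
def genExp : Fin 3 → ℤ × ℤ := ![(0, 0), (0, 0), -(0, 1)]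

theorem Gamma2.ofGen_ofIndex (t : Fin 3) (c : ℤ) :
    ofGen (Gen.ofIndex t c) = ⟨c * actUnit (genExp t), genShift t⟩ := by
  fin_cases t
  · simp [Gen.ofIndex, ofGen, genExp, genShift, actUnit]
  · simp [Gen.ofIndex, ofGen, genExp, genShift, actUnit]
  · exact ofGen_nu c

theorem Gamma2.mul_ofGen_ofIndex (g : Gamma2) (t : Fin 3) (c : ℤ) :
    g * ofGen (Gen.ofIndex t c) =
      ⟨g.poly + c * actUnit (g.shift + genExp t), g.shift + genShift t⟩ := by
  rw [ofGen_ofIndex, mul_def]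
  ext1
  · simp only [actUnit_add, Units.val_mul]
    ring
  · rfl

/-- The six vectors ±(1,0), ±(0,1), ±(1,-1) are distinct, so the ℤ²-component determines the type
and the sign; the polynomial component then determines the index. -/
theorem ofGen_injective_signed {x y : Gen} {b b' : Bool}
    (h : (if b then Gamma2.ofGen x else (Gamma2.ofGen x)⁻¹) =
      if b' then Gamma2.ofGen y else (Gamma2.ofGen y)⁻¹) : (x, b) = (y, b') := by
  obtain ⟨t, c, rfl⟩ := x.exists_ofIndex
  obtain ⟨t', c', rfl⟩ := y.exists_ofIndex
  have hsign : ∀ (b : Bool) (t : Fin 3) (c : ℤ), (if b then Gamma2.ofGen (Gen.ofIndex t c) else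
      (Gamma2.ofGen (Gen.ofIndex t c))⁻¹ : Gamma2).shift =
      if b then genShift t else -genShift t := by
    intro b t c
    rw [Gamma2.ofGen_ofIndex]
    cases b <;> rfl
  have hs := congrArg Gamma2.shift h
  rw [hsign, hsign] at hs
  obtain ⟨rfl, rfl⟩ : t = t' ∧ b = b' := by
    clear h hsign
    revert hs
    cases b <;> cases b' <;> fin_cases t <;> fin_cases t' <;> simp [genShift]
  have h' : Gamma2.ofGen (Gen.ofIndex t c) = Gamma2.ofGen (Gen.ofIndex t c') := by
    cases b
    · exact inv_injective h
    · exact h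
  rw [Gamma2.ofGen_ofIndex, Gamma2.ofGen_ofIndex, Gamma2.mk.injEq] at h'
  have hc : (c : LaurentRing) = c' := (actUnit (genExp t)).isUnit.mul_right_cancel h'.1
  have hc' : algebraMap ℤ[X] LaurentRing c = algebraMap ℤ[X] LaurentRing c' := by simpa using hc
  rw [Int.cast_injective (algebraMap_laurentRing_injective hc')]

namespace TreeCoordinates

variable {V : Type*} {T : SimpleGraph V} {ρ : ℤ → V} (C : TreeCoordinates T ρ)

theorem pos_mul_ofGen_up (t : Fin 3) (c : ℤ) (g : Gamma2) :
    treeParent T ρ (C.pos (genUp t) (g * Gamma2.ofGen (Gen.ofIndex t c))) =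
      C.pos (genUp t) g := by
  have h1 : placeWeight (genUp t) (genShift t) = 1 := by
    fin_cases t <;> simp [placeWeight, genUp, genShift]
  have h2 : placeShift (genUp t) ≤ placeWeight (genUp t) (genExp t) := by
    fin_cases t <;> simp [placeWeight, placeShift, genUp, genExp]
  rw [Gamma2.mul_ofGen_ofIndex, pos, placeWeight_add, h1, C.parent_node,
    C.node_add_mul_actUnit _ _ _ _ _ (by rw [placeWeight_add]; omega), pos]

theorem pos_mul_ofGen_down (t : Fin 3) (c : ℤ) (g : Gamma2) :
    treeParent T ρ (C.pos (genDown t) g) =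
      C.pos (genDown t) (g * Gamma2.ofGen (Gen.ofIndex t c)) := by
  have h1 : placeWeight (genDown t) (genShift t) = -1 := by
    fin_cases t <;> simp [placeWeight, genDown, genShift]
  -- The new height is one lower, so the added term may have order one less than the truncation
  -- degree at g.
  have h2 : placeShift (genDown t) - 1 ≤ placeWeight (genDown t) (genExp t) := by
    fin_cases t <;> simp [placeWeight, placeShift, genDown, genExp]
  have h3 := C.parent_node (placeWeight (genDown t) g.shift + -1) (placeSeries (genDown t) g.poly)
  rw [neg_add_cancel_right] at h3
  rw [Gamma2.mul_ofGen_ofIndex, pos, pos, placeWeight_add, h1,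
    C.node_add_mul_actUnit _ _ _ _ _ (by rw [placeWeight_add]; omega), h3]

theorem pos_mul_ofGen_stay (t : Fin 3) (c : ℤ) (g : Gamma2) :
    C.pos (genStay t) (g * Gamma2.ofGen (Gen.ofIndex t c)) = C.pos (genStay t) g := by
  have h1 : placeWeight (genStay t) (genShift t) = 0 := by
    fin_cases t <;> simp [placeWeight, genStay, genShift]
  -- For ν the unchanged place is ∞: its factor (1+x)⁻¹ vanishes there to order 1, which is exactly
  -- the shift.
  have h2 : placeShift (genStay t) ≤ placeWeight (genStay t) (genExp t) := by
    fin_cases t <;> simp [placeWeight, placeShift, genStay, genExp]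
  rw [Gamma2.mul_ofGen_ofIndex, pos, pos, placeWeight_add, h1, add_zero,
    C.node_add_mul_actUnit _ _ _ _ _ (by rw [placeWeight_add]; omega)]

theorem exists_pos_mul_ofGen (hT : T.IsTree) (hρ : IsGeodesicLine T ρ) (t : Fin 3) (g : Gamma2)
    (w : V) (hw : treeParent T ρ w = C.pos (genUp t) g) :
    ∃ c, C.pos (genUp t) (g * Gamma2.ofGen (Gen.ofIndex t c)) = w := by
  have h1 : placeWeight (genUp t) (genShift t) = 1 := by
    fin_cases t <;> simp [placeWeight, genUp, genShift]
  -- Equality, not just an inequality: the added term starts precisely at the coefficient that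
  -- selects the child.
  have h2 : placeShift (genUp t) = placeWeight (genUp t) (genExp t) := by
    fin_cases t <;> simp [placeWeight, placeShift, genUp, genExp]
  obtain ⟨c, hc⟩ := C.exists_node_add_mul_actUnit hT hρ (genUp t) g.poly (g.shift + genExp t)
    (placeWeight (genUp t) g.shift) (by rw [placeWeight_add]; omega) w hw
  refine ⟨c, ?_⟩
  rw [Gamma2.mul_ofGen_ofIndex, pos, placeWeight_add, h1, hc]

end TreeCoordinates

/-! ### Cells of one tree and the heights of their points. -/

section TreeCells

variable {V : Type*} {T : SimpleGraph V} {ρ : ℤ → V}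

/-- The vertex `a`, or the edge from `a` to its parent. -/
def treeCell (T : SimpleGraph V) (ρ : ℤ → V) (a : V) (b : Bool) : Set V :=
  if b then {treeParent T ρ a, a} else {a}

theorem treeParent_ne (hT : T.IsTree) (hρ : IsGeodesicLine T ρ) (a : V) : treeParent T ρ a ≠ a :=
  (treeParent_spec hT hρ a).1.ne'

theorem isGraphCell_iff (hT : T.IsTree) (hρ : IsGeodesicLine T ρ) (s : Set V) :
    IsGraphCell T s ↔ ∃ a b, s = treeCell T ρ a b := by
  constructor
  · rintro (⟨v, rfl⟩ | ⟨u, v, h, rfl⟩)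
    · exact ⟨v, false, rfl⟩
    · rcases (adj_iff_treeParent hT hρ u v).1 h with rfl | rfl
      · exact ⟨u, true, Set.pair_comm _ _⟩
      · exact ⟨v, true, rfl⟩
  · rintro ⟨a, b, rfl⟩
    cases b
    · exact .inl ⟨a, rfl⟩
    · exact .inr ⟨_, a, (treeParent_spec hT hρ a).1.symm, rfl⟩

theorem treeCell_true_injective (hT : T.IsTree) (hρ : IsGeodesicLine T ρ) {a a' : V}
    (h : treeCell T ρ a true = treeCell T ρ a' true) : a = a' := by
  have h1 : a ∈ treeCell T ρ a' true := h ▸ Set.mem_insert_of_mem _ rfl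
  have h2 : a' ∈ treeCell T ρ a true := h ▸ Set.mem_insert_of_mem _ rfl
  rcases h1 with h1 | h1
  · rcases h2 with h2 | h2
    · have e1 := (treeParent_spec hT hρ a).2
      have e2 := (treeParent_spec hT hρ a').2
      rw [← h2] at e1
      rw [← h1] at e2
      omega
    · exact h2.symm
  · exact h1

namespace GraphPoint

theorem pointHeight_of_supp_singleton {p : GraphPoint T} {a : V} (h : p.supp = {a}) :
    pointHeight T ρ p = vertexHeight T ρ a := by
  have hs : p.coord.support = {a} := Finset.coe_injective (by rw [Finset.coe_singleton]; exact h)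
  have h1 := p.sum_eq_one
  rw [Finsupp.sum, hs, Finset.sum_singleton] at h1
  rw [pointHeight, Finsupp.sum, hs, Finset.sum_singleton, h1, one_mul]

theorem pointHeight_of_supp_edge (hT : T.IsTree) (hρ : IsGeodesicLine T ρ) {p : GraphPoint T}
    {a : V} (h : p.supp = {treeParent T ρ a, a}) :
    pointHeight T ρ p = vertexHeight T ρ a - p.coord (treeParent T ρ a) ∧
      0 < p.coord (treeParent T ρ a) ∧ p.coord (treeParent T ρ a) < 1 := by
  classical
  have hne := treeParent_ne hT hρ a
  have hs : p.coord.support = {treeParent T ρ a, a} :=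
    Finset.coe_injective (by rw [Finset.coe_pair]; exact h)
  have h1 := p.sum_eq_one
  rw [Finsupp.sum, hs, Finset.sum_pair hne] at h1
  have hh : (vertexHeight T ρ (treeParent T ρ a) : ℝ) = vertexHeight T ρ a - 1 := by
    exact_mod_cast (treeParent_spec hT hρ a).2
  have ha : p.coord a ≠ 0 := Finsupp.mem_support_iff.1 (by simp [hs])
  have hb : p.coord (treeParent T ρ a) ≠ 0 := Finsupp.mem_support_iff.1 (by simp [hs])
  have ha' := lt_of_le_of_ne (p.nonneg a) ha.symm
  have hb' := lt_of_le_of_ne (p.nonneg (treeParent T ρ a)) hb.symm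
  refine ⟨?_, hb', by linarith⟩
  rw [pointHeight, Finsupp.sum, hs, Finset.sum_pair hne, hh]
  linear_combination (vertexHeight T ρ a : ℝ) * h1

theorem exists_supp_singleton (a : V) : ∃ p : GraphPoint T, p.supp = {a} := by
  have hs : ((Finsupp.single a (1 : ℝ)).support : Set V) = {a} := by
    rw [Finsupp.support_single _ one_ne_zero, Finset.coe_singleton]
  exact ⟨⟨Finsupp.single a 1, .inl ⟨a, hs⟩,
    fun v => Finsupp.single_nonneg.2 zero_le_one v, by simp⟩, hs⟩

theorem exists_supp_edge (hT : T.IsTree) (hρ : IsGeodesicLine T ρ) (a : V) {r : ℝ} (h0 : 0 < r)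
    (h1 : r < 1) : ∃ p : GraphPoint T, p.supp = {treeParent T ρ a, a} ∧
      p.coord (treeParent T ρ a) = r := by
  classical
  have hne := treeParent_ne hT hρ a
  let c : V →₀ ℝ := Finsupp.single (treeParent T ρ a) r + Finsupp.single a (1 - r)
  have hs : (c.support : Set V) = {treeParent T ρ a, a} := by
    ext v
    simp only [Finset.mem_coe, Finsupp.mem_support_iff, c, Finsupp.add_apply,
      Finsupp.single_apply, Set.mem_insert_iff, Set.mem_singleton_iff]
    have := h0.ne'
    have := (sub_pos.2 h1).ne'
    grind
  refine ⟨⟨c, .inr ⟨_, a, (treeParent_spec hT hρ a).1.symm, hs⟩, ?_, ?_⟩, hs, ?_⟩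
  · intro v
    exact add_nonneg (Finsupp.single_nonneg.2 h0.le v)
      (Finsupp.single_nonneg.2 (sub_pos.2 h1).le v)
  · rw [Finsupp.sum_add_index' (fun _ => rfl) (fun _ _ _ => rfl), Finsupp.sum_single_index rfl,
      Finsupp.sum_single_index rfl, add_sub_cancel]
  · simp [c, hne.symm]

theorem exists_supp_treeCell (hT : T.IsTree) (hρ : IsGeodesicLine T ρ) (a : V) (b : Bool) {r : ℝ}
    (hr : b = true → 0 < r ∧ r < 1) : ∃ p : GraphPoint T, p.supp = treeCell T ρ a b ∧
      pointHeight T ρ p = vertexHeight T ρ a - if b then r else 0 := by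
  cases b
  · obtain ⟨p, hp⟩ := exists_supp_singleton (T := T) a
    exact ⟨p, hp, by simp [pointHeight_of_supp_singleton hp]⟩
  · obtain ⟨p, hp, hpr⟩ := exists_supp_edge hT hρ a (hr rfl).1 (hr rfl).2
    exact ⟨p, hp, by rw [(pointHeight_of_supp_edge hT hρ hp).1, hpr]; rfl⟩

theorem pointHeight_of_supp_treeCell (hT : T.IsTree) (hρ : IsGeodesicLine T ρ) {p : GraphPoint T}
    {a : V} {b : Bool} (h : p.supp = treeCell T ρ a b) :
    ∃ r : ℝ, pointHeight T ρ p = vertexHeight T ρ a - r ∧ (b = false → r = 0) ∧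
      (b = true → 0 < r ∧ r < 1) := by
  cases b
  · exact ⟨0, by rw [pointHeight_of_supp_singleton h, sub_zero], by simp⟩
  · obtain ⟨h1, h2⟩ := pointHeight_of_supp_edge hT hρ h
    exact ⟨_, h1, by simp, fun _ => h2⟩

theorem pointHeight_isInt_iff (hT : T.IsTree) (hρ : IsGeodesicLine T ρ) {p : GraphPoint T}
    {a : V} {b : Bool} (h : p.supp = treeCell T ρ a b) :
    (∃ m : ℤ, pointHeight T ρ p = m) ↔ b = false := by
  obtain ⟨r, h1, h2, h3⟩ := pointHeight_of_supp_treeCell hT hρ h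
  constructor
  · rintro ⟨m, hm⟩
    by_contra hb
    obtain ⟨h4, h5⟩ := h3 (by simpa using hb)
    have h6 : r = ((vertexHeight T ρ a - m : ℤ) : ℝ) := by
      push_cast
      linarith
    rw [h6] at h4 h5
    have h7 : 0 < vertexHeight T ρ a - m := by exact_mod_cast h4
    have h8 : vertexHeight T ρ a - m < 1 := by exact_mod_cast h5
    omega
  · intro hb
    exact ⟨_, by rw [h1, h2 hb, sub_zero]⟩

end GraphPoint

end TreeCells

/-! ### Which product cells meet the horocyclic product, and in which dimension. -/

section HoroCells

variable {V : Type*} {T : SimpleGraph V} {ρ : ℤ → V}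

/-- The number of edges among the factors of a cell of the product of three trees. -/
def edgeCount (b : Fin 3 → Bool) : ℤ := ∑ i, if b i then 1 else 0

theorem ncard_setOf_fin_three (P : Fin 3 → Prop) (b : Fin 3 → Bool) (h : ∀ i, P i ↔ b i = false) :
    ({i | P i}.ncard : ℤ) = 3 - edgeCount b := by
  have h1 : {i | P i} = ((Finset.univ.filter fun i => b i = false : Finset (Fin 3)) : Set (Fin 3)) := by
    ext i
    simp [h]
  rw [h1, Set.ncard_coe_finset, edgeCount]
  clear h1 h
  revert b
  decide

/-- A point of the open cell has height sum S minus one parameter in (0,1) for each edge factor.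
Such parameters can add up to S exactly when S = 0 and there are no edges, or S lies strictly
between 0 and the number of edges. -/
theorem nonempty_horoOpenCell_iff (hT : T.IsTree) (hρ : IsGeodesicLine T ρ) (a : Fin 3 → V)
    (b : Fin 3 → Bool) :
    (horoOpenCell 2 T ρ fun i => treeCell T ρ (a i) (b i)).Nonempty ↔
      (edgeCount b = 0 ∧ ∑ i, vertexHeight T ρ (a i) = 0) ∨
      (0 < ∑ i, vertexHeight T ρ (a i) ∧ ∑ i, vertexHeight T ρ (a i) < edgeCount b) := by
  constructor
  · rintro ⟨p, hp, hs⟩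
    choose r h1 h2 h3 using fun i => GraphPoint.pointHeight_of_supp_treeCell hT hρ (hs i)
    have h4 : ∑ i, pointHeight T ρ (p i) = 0 := hp
    have h5 : ((∑ i, vertexHeight T ρ (a i) : ℤ) : ℝ) = r 0 + r 1 + r 2 := by
      simp only [h1, Finset.sum_sub_distrib, sub_eq_zero] at h4
      push_cast
      rw [h4]
      exact Fin.sum_univ_three r
    generalize ∑ i, vertexHeight T ρ (a i) = S at *
    have key : ∀ (z : ℤ), ((z : ℝ) = 0 → z = 0) ∧ (∀ n : ℤ, 0 < (z : ℝ) → (z : ℝ) < n → 0 < z ∧ z < n) :=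
      fun z => ⟨fun h => by exact_mod_cast h, fun n h h' => ⟨by exact_mod_cast h, by exact_mod_cast h'⟩⟩
    have hc : edgeCount b = (if b 0 then 1 else 0) + (if b 1 then 1 else 0) + if b 2 then 1 else 0 :=
      Fin.sum_univ_three _
    have e0 := h2 0
    have e1 := h2 1
    have e2 := h2 2
    have f0 := fun h => (h3 0 h).1
    have f1 := fun h => (h3 1 h).1
    have f2 := fun h => (h3 2 h).1
    have g0 := fun h => (h3 0 h).2
    have g1 := fun h => (h3 1 h).2
    have g2 := fun h => (h3 2 h).2
    rw [hc]
    generalize b 0 = b0 at *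
    generalize b 1 = b1 at *
    generalize b 2 = b2 at *
    cases b0 <;> cases b1 <;> cases b2 <;> simp at e0 e1 e2 f0 f1 f2 g0 g1 g2
    · exact .inl ⟨rfl, (key S).1 (by rw [h5, e0, e1, e2]; ring)⟩
    all_goals
      refine .inr ((key S).2 _ ?_ ?_) <;> rw [h5] <;> norm_num <;> linarith
  · intro h
    have hr : ∃ r : ℝ, (∀ i, b i = true → 0 < r ∧ r < 1) ∧
        (∑ i, vertexHeight T ρ (a i) : ℝ) = edgeCount b * r := by
      rcases h with ⟨h1, h2⟩ | ⟨h1, h2⟩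
      · refine ⟨0, ?_, ?_⟩
        · intro i hi
          exfalso
          revert i b
          decide
        · rw [mul_zero]
          exact_mod_cast h2
      · have h3 : (0 : ℝ) < edgeCount b := by exact_mod_cast h1.trans h2
        have h1' : (0 : ℝ) < ∑ i, (vertexHeight T ρ (a i) : ℝ) := by exact_mod_cast h1
        have h2' : ∑ i, (vertexHeight T ρ (a i) : ℝ) < edgeCount b := by exact_mod_cast h2
        -- All edge factors use the same parameter, namely S divided by their number.
        refine ⟨(∑ i, vertexHeight T ρ (a i) : ℝ) / edgeCount b, fun _ _ =>
          ⟨div_pos h1' h3, (div_lt_one h3).2 h2'⟩, ?_⟩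
        field_simp
    obtain ⟨r, hr, hsum⟩ := hr
    choose p hp hp' using fun i => GraphPoint.exists_supp_treeCell hT hρ (a i) (b i) (hr i)
    refine ⟨p, ?_, hp⟩
    change ∑ i, pointHeight T ρ (p i) = 0
    simp only [hp', Finset.sum_sub_distrib]
    rw [sub_eq_zero]
    refine hsum.trans ?_
    rw [edgeCount]
    push_cast
    rw [Finset.sum_mul]
    exact Finset.sum_congr rfl fun i _ => by split_ifs <;> simp

/-- Exactly the vertex factors have integral height, and there are 3 minus the number of edges of
them. -/
theorem mem_horoSkeleton_iff (hT : T.IsTree) (hρ : IsGeodesicLine T ρ) {a : Fin 3 → V}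
    {b : Fin 3 → Bool} {p : Fin 3 → GraphPoint T}
    (hp : p ∈ horoOpenCell 2 T ρ fun i => treeCell T ρ (a i) (b i)) (k : ℕ) :
    p ∈ horoSkeleton 2 T ρ k ↔ edgeCount b ≤ k + 1 := by
  have h := ncard_setOf_fin_three (fun i => ∃ m : ℤ, pointHeight T ρ (p i) = m) b
    (fun i => GraphPoint.pointHeight_isInt_iff hT hρ (hp.2 i))
  constructor
  · rintro ⟨-, h'⟩
    change 2 ≤ k + {i : Fin 3 | ∃ m : ℤ, pointHeight T ρ (p i) = m}.ncard at h'
    omega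
  · intro h'
    refine ⟨hp.1, ?_⟩
    change 2 ≤ k + {i : Fin 3 | ∃ m : ℤ, pointHeight T ρ (p i) = m}.ncard
    omega

/-- The cell of the horocyclic product with the given factors. -/
def mkHoroCell (hT : T.IsTree) (hρ : IsGeodesicLine T ρ) (k : ℕ) (s : Fin 3 → Set V)
    (h : ∃ (a : Fin 3 → V) (b : Fin 3 → Bool), (∀ i, s i = treeCell T ρ (a i) (b i)) ∧
      ((edgeCount b = 0 ∧ ∑ i, vertexHeight T ρ (a i) = 0) ∨
      (0 < ∑ i, vertexHeight T ρ (a i) ∧ ∑ i, vertexHeight T ρ (a i) < edgeCount b)) ∧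
      (edgeCount b ≤ k + 1 ∧ (k = 0 ∨ k < edgeCount b))) : HoroCell 2 T ρ k where
  carrier := s
  isCell := by
    obtain ⟨a, b, hs, -⟩ := h
    exact fun i => (isGraphCell_iff hT hρ _).2 ⟨a i, b i, hs i⟩
  nonempty := by
    obtain ⟨a, b, hs, h, -⟩ := h
    obtain rfl : s = fun i => treeCell T ρ (a i) (b i) := funext hs
    exact (nonempty_horoOpenCell_iff hT hρ a b).2 h
  dim_eq := by
    obtain ⟨a, b, hs, -, h1, h2⟩ := h
    obtain rfl : s = fun i => treeCell T ρ (a i) (b i) := funext hs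
    intro p hp
    refine ⟨(mem_horoSkeleton_iff hT hρ hp k).2 h1, fun j hj => ?_⟩
    rw [mem_horoSkeleton_iff hT hρ hp]
    omega

theorem HoroCell.exists_treeCell (hT : T.IsTree) (hρ : IsGeodesicLine T ρ) {k : ℕ}
    (c : HoroCell 2 T ρ k) :
    ∃ (a : Fin 3 → V) (b : Fin 3 → Bool), (∀ i, c.carrier i = treeCell T ρ (a i) (b i)) ∧
      ((edgeCount b = 0 ∧ ∑ i, vertexHeight T ρ (a i) = 0) ∨
      (0 < ∑ i, vertexHeight T ρ (a i) ∧ ∑ i, vertexHeight T ρ (a i) < edgeCount b)) ∧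
      (edgeCount b ≤ k + 1 ∧ (k = 0 ∨ k < edgeCount b)) := by
  obtain ⟨s, hc, hne, hdim⟩ := c
  choose a b hs using fun i => (isGraphCell_iff hT hρ _).1 (hc i)
  obtain rfl : s = fun i => treeCell T ρ (a i) (b i) := funext hs
  refine ⟨a, b, fun i => rfl, (nonempty_horoOpenCell_iff hT hρ a b).1 hne, ?_⟩
  obtain ⟨p, hp⟩ := hne
  obtain ⟨h1, h2⟩ := hdim p hp
  rw [mem_horoSkeleton_iff hT hρ hp] at h1
  refine ⟨h1, ?_⟩
  rcases k with _ | k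
  · exact .inl rfl
  · have h3 := h2 k (Nat.lt_succ_self k)
    rw [mem_horoSkeleton_iff hT hρ hp] at h3
    right
    push_cast
    omega

/-- An open cell is non-empty, and the supports of any of its points recover its factors. -/
theorem HoroCell.liesIn_iff {k l : ℕ} (c : HoroCell 2 T ρ k) (d : HoroCell 2 T ρ l) :
    c.LiesIn d ↔ ∀ i, c.carrier i ⊆ d.carrier i := by
  constructor
  · intro h i
    obtain ⟨p, hp⟩ := c.nonempty
    have h1 := (h hp).2 i
    rwa [hp.2 i] at h1
  · intro h p hp
    exact ⟨hp.1, fun i => (hp.2 i).trans_subset (h i)⟩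

end HoroCells

/-! ### Letters as group elements. -/

section Letters

theorem wordElt_true (x : Gen) : wordElt gammaRels [(x, true)] = PresentedGroup.of x := rfl

theorem wordElt_false (x : Gen) : wordElt gammaRels [(x, false)] = (PresentedGroup.of x)⁻¹ :=
  wordElt_flip gammaRels x true

theorem presEquivGamma_letter (x : Gen) (b : Bool) : presEquivGamma (wordElt gammaRels [(x, b)]) =
    if b then Gamma2.ofGen x else (Gamma2.ofGen x)⁻¹ := by
  cases b
  · rw [wordElt_false, map_inv, presEquivGamma_of]; rfl
  · rw [wordElt_true, presEquivGamma_of]; rfl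

theorem letter_injective {x y : Gen × Bool}
    (h : wordElt gammaRels [x] = wordElt gammaRels [y]) : x = y := by
  obtain ⟨x, b⟩ := x
  obtain ⟨y, b'⟩ := y
  have h' := congrArg presEquivGamma h
  rw [presEquivGamma_letter, presEquivGamma_letter] at h'
  exact ofGen_injective_signed h'

/-- Every edge of the Cayley graph is, up to its orientation, labelled by a generator. -/
theorem letter_cases (g : PresGroup gammaRels) (x : Gen × Bool) :
    ∃ t c, g * wordElt gammaRels [x] = g * PresentedGroup.of (Gen.ofIndex t c) ∨
      g = g * wordElt gammaRels [x] * PresentedGroup.of (Gen.ofIndex t c) := by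
  obtain ⟨x, b⟩ := x
  obtain ⟨t, c, rfl⟩ := x.exists_ofIndex
  refine ⟨t, c, ?_⟩
  cases b
  · right
    rw [wordElt_false, inv_mul_cancel_right]
  · exact .inl rfl

end Letters

/-! ### Vertices, edges and triangles in tree coordinates. -/

theorem forall_gen_directions {Q : Fin 3 → Prop} (t : Fin 3) :
    (∀ i, Q i) ↔ Q (genUp t) ∧ Q (genDown t) ∧ Q (genStay t) := by
  fin_cases t <;> simp [Fin.forall_fin_succ, genUp, genDown, genStay] <;> tauto

theorem sum_gen_directions (f : Fin 3 → ℤ) (t : Fin 3) :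
    ∑ i, f i = f (genUp t) + f (genDown t) + f (genStay t) := by
  rw [Fin.sum_univ_three]
  fin_cases t <;> simp [genUp, genDown, genStay] <;> ring

theorem gen_directions_ne (t : Fin 3) :
    genUp t ≠ genDown t ∧ genUp t ≠ genStay t ∧ genDown t ≠ genStay t := by
  revert t
  decide

namespace TreeCoordinates

variable {V : Type*} {T : SimpleGraph V} {ρ : ℤ → V} (C : TreeCoordinates T ρ)

/-- The vertex of the horocyclic product that belongs to an element of the presented group. -/
noncomputable def vert (g : PresGroup gammaRels) (i : Fin 3) : V := C.pos i (presEquivGamma g)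

theorem vert_injective {g g' : PresGroup gammaRels} (h : ∀ i, C.vert g i = C.vert g' i) : g = g' :=
  presEquivGamma.injective (C.pos_injective h)

theorem exists_vert_eq (v : Fin 3 → V) (hv : ∑ i, vertexHeight T ρ (v i) = 0) :
    ∃ g, ∀ i, C.vert g i = v i := by
  obtain ⟨g, hg⟩ := C.exists_pos_eq v hv
  exact ⟨presEquivGamma.symm g, fun i => by rw [vert, MulEquiv.apply_symm_apply, hg]⟩

theorem sum_height_vert (g : PresGroup gammaRels) : ∑ i, vertexHeight T ρ (C.vert g i) = 0 := by
  simp [vert, height_pos, Fin.sum_univ_three, placeWeight]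

theorem vert_up (g : PresGroup gammaRels) (t : Fin 3) (c : ℤ) :
    treeParent T ρ (C.vert (g * PresentedGroup.of (Gen.ofIndex t c)) (genUp t)) =
      C.vert g (genUp t) := by
  rw [vert, map_mul, presEquivGamma_of, C.pos_mul_ofGen_up, vert]

theorem vert_down (g : PresGroup gammaRels) (t : Fin 3) (c : ℤ) :
    treeParent T ρ (C.vert g (genDown t)) =
      C.vert (g * PresentedGroup.of (Gen.ofIndex t c)) (genDown t) := by
  rw [vert, vert, map_mul, presEquivGamma_of, C.pos_mul_ofGen_down]

theorem vert_stay (g : PresGroup gammaRels) (t : Fin 3) (c : ℤ) :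
    C.vert (g * PresentedGroup.of (Gen.ofIndex t c)) (genStay t) = C.vert g (genStay t) := by
  rw [vert, map_mul, presEquivGamma_of, C.pos_mul_ofGen_stay, vert]

theorem exists_vert_up (hT : T.IsTree) (hρ : IsGeodesicLine T ρ) (g : PresGroup gammaRels) (t : Fin 3) (w : V)
    (hw : treeParent T ρ w = C.vert g (genUp t)) :
    ∃ c, C.vert (g * PresentedGroup.of (Gen.ofIndex t c)) (genUp t) = w := by
  obtain ⟨c, hc⟩ := C.exists_pos_mul_ofGen hT hρ t (presEquivGamma g) w hw
  exact ⟨c, by rw [vert, map_mul, presEquivGamma_of, hc]⟩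

/-- The two end points differ in two coordinates, one going up and one going down. Taking these
coordinates from different end points would give height sum ±1 instead of 0. -/
theorem eq_or_eq_of_vert_gen (hT : T.IsTree) (hρ : IsGeodesicLine T ρ) (g : PresGroup gammaRels) (t : Fin 3) (c : ℤ)
    (v : PresGroup gammaRels) (hv : ∀ i, C.vert v i = C.vert g i ∨
      C.vert v i = C.vert (g * PresentedGroup.of (Gen.ofIndex t c)) i) :
    v = g ∨ v = g * PresentedGroup.of (Gen.ofIndex t c) := by
  have h1 := C.vert_up g t c
  have h2 := C.vert_down g t c
  have h3 := C.vert_stay g t c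
  have e0 := C.sum_height_vert g
  have e1 := C.sum_height_vert (g * PresentedGroup.of (Gen.ofIndex t c))
  have e2 := C.sum_height_vert v
  have k1 := (treeParent_spec hT hρ
    (C.vert (g * PresentedGroup.of (Gen.ofIndex t c)) (genUp t))).2
  have k2 := (treeParent_spec hT hρ (C.vert g (genDown t))).2
  rw [h1] at k1
  rw [h2] at k2
  rw [sum_gen_directions _ t] at e0 e1 e2
  rw [forall_gen_directions t] at hv
  obtain ⟨v1, v2, v3⟩ := hv
  rw [h3, or_self] at v3
  rw [v3] at e2
  rw [h3] at e1
  rcases v1 with v1 | v1 <;> rcases v2 with v2 | v2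
  · exact .inl (C.vert_injective ((forall_gen_directions t).2 ⟨v1, v2, v3⟩))
  · rw [v1, v2] at e2
    omega
  · rw [v1, v2] at e2
    omega
  · exact .inr (C.vert_injective ((forall_gen_directions t).2 ⟨v1, v2, v3.trans h3.symm⟩))

theorem eq_or_eq_of_vert (hT : T.IsTree) (hρ : IsGeodesicLine T ρ) (g : PresGroup gammaRels) (x : Gen × Bool)
    (v : PresGroup gammaRels) (hv : ∀ i, C.vert v i = C.vert g i ∨
      C.vert v i = C.vert (g * wordElt gammaRels [x]) i) :
    v = g ∨ v = g * wordElt gammaRels [x] := by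
  obtain ⟨t, c, h | h⟩ := letter_cases g x
  · rw [h] at hv ⊢
    exact C.eq_or_eq_of_vert_gen hT hρ g t c v hv
  · have := C.eq_or_eq_of_vert_gen hT hρ (g * wordElt gammaRels [x]) t c v
      (by rw [← h]; exact fun i => (hv i).symm)
    rw [← h] at this
    exact this.symm

theorem mul_letter_ne (C : TreeCoordinates T ρ) (hT : T.IsTree) (hρ : IsGeodesicLine T ρ) 
    (g : PresGroup gammaRels) (x : Gen × Bool) :
    g * wordElt gammaRels [x] ≠ g := by
  intro h
  obtain ⟨t, c, h' | h'⟩ := letter_cases g x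
  · have h1 := C.vert_up g t c
    rw [← h', h] at h1
    exact treeParent_ne hT hρ _ h1
  · have h1 := C.vert_up g t c
    rw [h, eq_comm] at h'
    rw [h'] at h1
    exact treeParent_ne hT hρ _ h1

/-- The factors of the edge between two vertices of the horocyclic product. -/
theorem edge_carrier_gen (hT : T.IsTree) (hρ : IsGeodesicLine T ρ) (g : PresGroup gammaRels) (t : Fin 3) (c : ℤ) :
    ∃ (a : Fin 3 → V) (b : Fin 3 → Bool),
      (∀ i, ({C.vert g i, C.vert (g * PresentedGroup.of (Gen.ofIndex t c)) i} : Set V) =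
        treeCell T ρ (a i) (b i)) ∧
      edgeCount b = 2 ∧ ∑ i, vertexHeight T ρ (a i) = 1 := by
  have h1 := C.vert_up g t c
  have h2 := C.vert_down g t c
  have h3 := C.vert_stay g t c
  have e0 := C.sum_height_vert g
  have k1 := (treeParent_spec hT hρ
    (C.vert (g * PresentedGroup.of (Gen.ofIndex t c)) (genUp t))).2
  obtain ⟨n1, n2, n3⟩ := gen_directions_ne t
  -- Each edge factor is named by its upper vertex: that of the product in the rising coordinate and
  -- that of g in the falling one. This raises the height sum from 0 to 1.
  refine ⟨fun i => if i = genUp t then C.vert (g * PresentedGroup.of (Gen.ofIndex t c)) i else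
    C.vert g i, fun i => decide (i ≠ genStay t), ?_, ?_, ?_⟩
  · rw [forall_gen_directions t]
    refine ⟨?_, ?_, ?_⟩
    · simp [treeCell, n2, h1]
    · simp [treeCell, n1.symm, n3, h2, Set.pair_comm]
    · simp [treeCell, n2.symm, h3]
  · rw [edgeCount, sum_gen_directions _ t]
    simp [n2, n3]
  · rw [h1] at k1
    rw [sum_gen_directions _ t] at e0 ⊢
    beta_reduce
    rw [if_pos rfl, if_neg n1.symm, if_neg n2.symm]
    omega

theorem edge_carrier (hT : T.IsTree) (hρ : IsGeodesicLine T ρ) (g : PresGroup gammaRels) (x : Gen × Bool) :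
    ∃ (a : Fin 3 → V) (b : Fin 3 → Bool),
      (∀ i, ({C.vert g i, C.vert (g * wordElt gammaRels [x]) i} : Set V) =
        treeCell T ρ (a i) (b i)) ∧
      edgeCount b = 2 ∧ ∑ i, vertexHeight T ρ (a i) = 1 := by
  obtain ⟨t, c, h | h⟩ := letter_cases g x
  · rw [h]
    exact C.edge_carrier_gen hT hρ g t c
  · have := C.edge_carrier_gen hT hρ (g * wordElt gammaRels [x]) t c
    rw [← h] at this
    simpa only [Set.pair_comm] using this

theorem exists_edge_carrier (hT : T.IsTree) (hρ : IsGeodesicLine T ρ) (a : Fin 3 → V) (b : Fin 3 → Bool) (hb : edgeCount b = 2)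
    (ha : ∑ i, vertexHeight T ρ (a i) = 1) :
    ∃ g x, ∀ i, ({C.vert g i, C.vert (g * wordElt gammaRels [x]) i} : Set V) =
      treeCell T ρ (a i) (b i) := by
  -- The position of the single vertex factor determines the type of the generator.
  obtain ⟨t, hu, hd, hs⟩ : ∃ t, b (genUp t) = true ∧ b (genDown t) = true ∧
      b (genStay t) = false := by
    clear ha
    revert b
    decide
  obtain ⟨n1, n2, n3⟩ := gen_directions_ne t
  have k1 := (treeParent_spec hT hρ (a (genUp t))).2
  obtain ⟨g, hg⟩ := C.exists_vert_eq (Function.update a (genUp t) (treeParent T ρ (a (genUp t))))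
    (by
      rw [sum_gen_directions _ t] at ha ⊢
      rw [Function.update_self, Function.update_of_ne n1.symm, Function.update_of_ne n2.symm]
      omega)
  have g1 := hg (genUp t)
  have g2 := hg (genDown t)
  have g3 := hg (genStay t)
  rw [Function.update_self] at g1
  rw [Function.update_of_ne n1.symm] at g2
  rw [Function.update_of_ne n2.symm] at g3
  obtain ⟨c, hc⟩ := C.exists_vert_up hT hρ g t (a (genUp t)) g1.symm
  refine ⟨g, (Gen.ofIndex t c, true), ?_⟩
  rw [wordElt_true, forall_gen_directions t]
  refine ⟨?_, ?_, ?_⟩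
  · rw [g1, hc, hu]; rfl
  · rw [← C.vert_down, g2, hd, Set.pair_comm]; rfl
  · rw [C.vert_stay, g3, hs, Set.pair_eq_singleton]; rfl

/-- The vertices of a 2-cell whose factors are the edges below `a 0`, `a 1` and `a 2`: in the
coordinate `i` they are at the bottom if `s = true`, and at the top if `s = false`. -/
noncomputable def corner (T : SimpleGraph V) (ρ : ℤ → V) (a : Fin 3 → V) (s : Bool) (i j : Fin 3) : V :=
  if decide (j = i) = s then treeParent T ρ (a j) else a j

theorem corner_set (a : Fin 3 → V) (s : Bool) (j : Fin 3) :
    ({corner T ρ a s 2 j, corner T ρ a s 0 j, corner T ρ a s 1 j} : Set V) =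
      treeCell T ρ (a j) true := by
  ext w
  cases s <;> fin_cases j <;> simp [corner, treeCell] <;> tauto

/-- The boundary path of the 2-cell `f` passes through the corners of the 2-cell of the horocyclic
product given by `a` and `s`. -/
def IsFaceAt (f : PresGroup gammaRels × gammaRels) (a : Fin 3 → V) (s : Bool) : Prop :=
  ∃ g₁ g₂ x₁ x₂ x₃, f.2.1 = [x₁, x₂, x₃] ∧ f.1 * wordElt gammaRels [x₁] = g₁ ∧
    g₁ * wordElt gammaRels [x₂] = g₂ ∧ g₂ * wordElt gammaRels [x₃] = f.1 ∧
    (∀ j, C.vert f.1 j = corner T ρ a s 2 j) ∧ (∀ j, C.vert g₁ j = corner T ρ a s 0 j) ∧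
    ∀ j, C.vert g₂ j = corner T ρ a s 1 j

/-- The relator `λ_c⁻¹ ν_c μ_c`. -/
def lowRel (c : ℤ) : gammaRels :=
  ⟨[(Gen.lam c, false), (Gen.nu c, true), (Gen.mu c, true)], .inl ⟨c, rfl⟩⟩

/-- The relator `λ_{c+d} ν_d⁻¹ μ_c⁻¹`. -/
def highRel (c d : ℤ) : gammaRels :=
  ⟨[(Gen.lam (c + d), true), (Gen.nu d, false), (Gen.mu c, false)], .inr ⟨(c, d), rfl⟩⟩

theorem isFaceAt_lowRel (a : Fin 3 → V) (g : PresGroup gammaRels) (c : ℤ)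
    (h : ∀ j, C.vert g j = corner T ρ a true 0 j)
    (h0 : C.vert (g * PresentedGroup.of (Gen.lam c)) 0 = a 0) :
    C.IsFaceAt (g * PresentedGroup.of (Gen.lam c), lowRel c) a true := by
  have hrel := presGroup_lam_eq c
  have e0 : C.vert g 0 = treeParent T ρ (a 0) := h 0
  have e1 : C.vert g 1 = a 1 := h 1
  have e2 : C.vert g 2 = a 2 := h 2
  have l1 := C.vert_down g 0 c
  have l2 := C.vert_stay g 0 c
  have n1 := C.vert_down g 2 c
  have n2 := C.vert_stay g 2 c
  have m1 := C.vert_stay (g * PresentedGroup.of (Gen.nu c)) 1 c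
  simp only [genDown, genStay, Gen.ofIndex, Matrix.cons_val, mul_assoc, ← hrel]
    at l1 l2 n1 n2 m1
  refine ⟨g, g * PresentedGroup.of (Gen.nu c), _, _, _, rfl, ?_, rfl, ?_, ?_, h, ?_⟩
  · rw [wordElt_false, mul_inv_cancel_right]
  · rw [wordElt_true, mul_assoc, ← hrel]
  · rw [Fin.forall_fin_succ, Fin.forall_fin_two]
    exact ⟨h0, l2.trans e1, l1.symm.trans (congrArg _ e2)⟩
  · rw [Fin.forall_fin_succ, Fin.forall_fin_two]
    refine ⟨?_, ?_, n2.trans e2⟩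
    · exact m1.symm.trans h0
    · exact n1.symm.trans (congrArg _ e1)

theorem isFaceAt_highRel (a : Fin 3 → V) (g : PresGroup gammaRels) (c d : ℤ)
    (h : ∀ j, C.vert g j = corner T ρ a false 2 j)
    (h0 : C.vert (g * PresentedGroup.of (Gen.lam (c + d))) 0 = a 0)
    (h1 : C.vert (g * PresentedGroup.of (Gen.mu c)) 1 = a 1) :
    C.IsFaceAt (g, highRel c d) a false := by
  have hrel := presGroup_lam_add c d
  have e0 : C.vert g 0 = treeParent T ρ (a 0) := h 0
  have e1 : C.vert g 1 = treeParent T ρ (a 1) := h 1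
  have e2 : C.vert g 2 = a 2 := h 2
  have l1 := C.vert_down g 0 (c + d)
  have l2 := C.vert_stay g 0 (c + d)
  have m1 := C.vert_down g 1 c
  have m2 := C.vert_stay g 1 c
  simp only [genDown, genStay, Gen.ofIndex, Matrix.cons_val] at l1 l2 m1 m2
  refine ⟨g * PresentedGroup.of (Gen.lam (c + d)), g * PresentedGroup.of (Gen.mu c), _, _, _, rfl,
    rfl, ?_, ?_, h, ?_, ?_⟩
  · rw [wordElt_false, hrel, ← mul_assoc, mul_inv_cancel_right]
  · rw [wordElt_false, mul_inv_cancel_right]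
  · rw [Fin.forall_fin_succ, Fin.forall_fin_two]
    exact ⟨h0, l2.trans e1, l1.symm.trans (congrArg _ e2)⟩
  · rw [Fin.forall_fin_succ, Fin.forall_fin_two]
    exact ⟨m2.trans e0, h1, m1.symm.trans (congrArg _ e2)⟩

theorem exists_isFaceAt (f : PresGroup gammaRels × gammaRels) : ∃ a s, C.IsFaceAt f a s := by
  obtain ⟨g, r, hr⟩ := f
  rcases id hr with ⟨c, rfl⟩ | ⟨⟨c, d⟩, rfl⟩
  · let x := g * (PresentedGroup.of (Gen.lam c))⁻¹
    have hx : g = x * PresentedGroup.of (Gen.lam c) := (inv_mul_cancel_right _ _).symm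
    have := C.isFaceAt_lowRel ![C.vert g 0, C.vert x 1, C.vert x 2] x c (by
      rw [Fin.forall_fin_succ, Fin.forall_fin_two]
      have h := C.vert_up x 0 c
      refine ⟨?_, rfl, rfl⟩
      rw [hx]
      exact h.symm) (by rw [← hx]; rfl)
    rw [← hx] at this
    exact ⟨_, _, this⟩
  · refine ⟨_, _, C.isFaceAt_highRel ![C.vert (g * PresentedGroup.of (Gen.lam (c + d))) 0,
      C.vert (g * PresentedGroup.of (Gen.mu c)) 1, C.vert g 2] g c d ?_ rfl rfl⟩
    rw [Fin.forall_fin_succ, Fin.forall_fin_two]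
    exact ⟨(C.vert_up g 0 (c + d)).symm, (C.vert_up g 1 c).symm, rfl⟩

theorem sum_height_of_corner (hT : T.IsTree) (hρ : IsGeodesicLine T ρ) (a : Fin 3 → V) (s : Bool) (i : Fin 3) :
    ∑ j, vertexHeight T ρ (corner T ρ a s i j) =
      ∑ j, vertexHeight T ρ (a j) - if s then 1 else 2 := by
  have h := fun j => (treeParent_spec hT hρ (a j)).2
  rw [Fin.sum_univ_three, Fin.sum_univ_three]
  cases s <;> fin_cases i <;> simp [corner, h] <;> ring

theorem IsFaceAt.sum_height (hT : T.IsTree) (hρ : IsGeodesicLine T ρ) {f : PresGroup gammaRels × gammaRels} {a : Fin 3 → V} {s : Bool}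
    {C : TreeCoordinates T ρ} (h : C.IsFaceAt f a s) : ∑ j, vertexHeight T ρ (a j) = if s then 1 else 2 := by
  obtain ⟨g₁, g₂, x₁, x₂, x₃, -, -, -, -, h, -, -⟩ := h
  have h1 := C.sum_height_vert f.1
  simp only [h] at h1
  rw [sum_height_of_corner hT hρ] at h1
  omega

/-- Every corner has height sum 0, so it is a group element. Starting at corner 0 if S = 1, or at
corner 2 if S = 2, the indices of the generators are chosen so as to reach the prescribed upper
vertices. -/
theorem exists_isFaceAt_of_sum (hT : T.IsTree) (hρ : IsGeodesicLine T ρ) (a : Fin 3 → V) (s : Bool)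
    (h : ∑ j, vertexHeight T ρ (a j) = if s then 1 else 2) : ∃ f, C.IsFaceAt f a s := by
  have hc := fun i => C.exists_vert_eq (corner T ρ a s i)
    (by rw [sum_height_of_corner hT hρ, h, sub_self])
  cases s
  · obtain ⟨g, hg⟩ := hc 2
    obtain ⟨c, hc⟩ := C.exists_vert_up hT hρ g 1 (a 1) (hg 1).symm
    obtain ⟨k, hk⟩ := C.exists_vert_up hT hρ g 0 (a 0) (hg 0).symm
    -- The edges λ_k and μ_c leave the same corner with independent indices; the third side is
    -- ν_{k-c}, as k = c + (k - c).
    refine ⟨_, C.isFaceAt_highRel a g c (k - c) hg ?_ hc⟩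
    rw [add_sub_cancel]
    exact hk
  · obtain ⟨g, hg⟩ := hc 0
    obtain ⟨c, hc⟩ := C.exists_vert_up hT hρ g 0 (a 0) (hg 0).symm
    exact ⟨_, C.isFaceAt_lowRel a g c hg hc⟩

theorem exists_eq_corner (hT : T.IsTree) (hρ : IsGeodesicLine T ρ) (a : Fin 3 → V) (s : Bool)
    (h : ∑ j, vertexHeight T ρ (a j) = if s then 1 else 2) (g : PresGroup gammaRels)
    (hg : ∀ j, C.vert g j ∈ treeCell T ρ (a j) true) : ∃ i, ∀ j, C.vert g j = corner T ρ a s i j := by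
  have h1 := C.sum_height_vert g
  have hp := fun j => (treeParent_spec hT hρ (a j)).2
  rw [Fin.sum_univ_three] at h h1
  have g0 : C.vert g 0 = treeParent T ρ (a 0) ∨ C.vert g 0 = a 0 := hg 0
  have g1 : C.vert g 1 = treeParent T ρ (a 1) ∨ C.vert g 1 = a 1 := hg 1
  have g2 : C.vert g 2 = treeParent T ρ (a 2) ∨ C.vert g 2 = a 2 := hg 2
  -- Of the eight vertices of the cube, height sum 0 leaves those with one coordinate at the bottom
  -- if S = 1, and those with one at the top if S = 2.
  rcases g0 with g0 | g0 <;> rcases g1 with g1 | g1 <;> rcases g2 with g2 | g2 <;>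
    rw [g0, g1, g2] at h1 <;> (try simp only [hp] at h1) <;> cases s <;> simp at h <;>
    first
    | (exfalso; omega)
    | exact ⟨0, by rw [Fin.forall_fin_succ, Fin.forall_fin_two]; exact ⟨g0, g1, g2⟩⟩
    | exact ⟨1, by rw [Fin.forall_fin_succ, Fin.forall_fin_two]; exact ⟨g0, g1, g2⟩⟩
    | exact ⟨2, by rw [Fin.forall_fin_succ, Fin.forall_fin_two]; exact ⟨g0, g1, g2⟩⟩

end TreeCoordinates

/-! ### The isomorphism of 2-complexes. -/

namespace TreeCoordinates

variable {V : Type*} {T : SimpleGraph V} {ρ : ℤ → V} (C : TreeCoordinates T ρ)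
  (hT : T.IsTree) (hρ : IsGeodesicLine T ρ)

/-- The 0-cell of the horocyclic product that belongs to a group element. -/
def vertexCell (g : PresGroup gammaRels) : HoroCell 2 T ρ 0 :=
  mkHoroCell hT hρ 0 (fun i => {C.vert g i}) ⟨C.vert g, fun _ => false, fun _ => rfl,
    .inl ⟨by simp [edgeCount], C.sum_height_vert g⟩, by simp [edgeCount], .inl rfl⟩

/-- The 1-cell of the horocyclic product that belongs to an edge of the Cayley graph. -/
def edgeCell (e : PresGroup gammaRels × (Gen × Bool)) : HoroCell 2 T ρ 1 :=
  mkHoroCell hT hρ 1 (fun i => {C.vert e.1 i, C.vert (e.1 * wordElt gammaRels [e.2]) i}) (by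
    obtain ⟨a, b, h, h1, h2⟩ := C.edge_carrier hT hρ e.1 e.2
    exact ⟨a, b, h, .inr (by omega), by omega, .inr (by omega)⟩)

variable {C} in
theorem IsFaceAt.carrier_eq {f : PresGroup gammaRels × gammaRels} {a : Fin 3 → V} {s : Bool}
    (h : C.IsFaceAt f a s) (i : Fin 3) :
    {w | ∃ e ∈ cayleyPath gammaRels f.1 f.2.1, C.vert e.1 i = w} = treeCell T ρ (a i) true := by
  obtain ⟨g₁, g₂, x₁, x₂, x₃, hr, rfl, rfl, -, h0, h1, h2⟩ := h
  rw [← corner_set (T := T) (ρ := ρ) a s i, hr]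
  ext w
  simp [cayleyPath, h0, h1, h2, eq_comm]

/-- The 2-cell of the horocyclic product that belongs to a 2-cell of the Cayley complex. -/
def faceCell (f : PresGroup gammaRels × gammaRels) : HoroCell 2 T ρ 2 :=
  mkHoroCell hT hρ 2 (fun i => {w | ∃ e ∈ cayleyPath gammaRels f.1 f.2.1, C.vert e.1 i = w}) (by
    obtain ⟨a, s, h⟩ := C.exists_isFaceAt f
    have h1 := h.sum_height hT hρ
    have h2 : edgeCount (fun _ => true) = 3 := by decide
    refine ⟨a, fun _ => true, h.carrier_eq, .inr ?_, by omega, .inr (by omega)⟩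
    rw [h1, h2]
    cases s <;> simp)

theorem vertexCell_bijective : Function.Bijective (C.vertexCell hT hρ) := by
  constructor
  · intro g g' h
    refine C.vert_injective fun i => ?_
    exact Set.singleton_injective (congrFun (congrArg HoroCell.carrier h) i)
  · intro c
    obtain ⟨a, b, hc, h1, h2, h3⟩ := c.exists_treeCell hT hρ
    have hb : edgeCount b = 0 := by omega
    have hb' : b = fun _ => false := by
      clear hc h1 h2 h3
      revert b
      decide
    obtain ⟨g, hg⟩ := C.exists_vert_eq a (by omega)
    refine ⟨g, HoroCell.ext (funext fun i => ?_)⟩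
    rw [hc, hb', ← hg]
    rfl

theorem edgeCell_surjective : Function.Surjective (C.edgeCell hT hρ) := by
  intro c
  obtain ⟨a, b, hc, h1, h2, h3⟩ := c.exists_treeCell hT hρ
  obtain ⟨g, x, hg⟩ := C.exists_edge_carrier hT hρ a b (by omega) (by omega)
  exact ⟨(g, x), HoroCell.ext (funext fun i => (hg i).trans (hc i).symm)⟩

theorem vertexCell_liesIn_edgeCell (e : PresGroup gammaRels × (Gen × Bool))
    (v : PresGroup gammaRels) : (C.vertexCell hT hρ v).LiesIn (C.edgeCell hT hρ e) ↔
      v = e.1 ∨ v = e.1 * wordElt gammaRels [e.2] := by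
  rw [HoroCell.liesIn_iff]
  have h : (∀ i, (C.vertexCell hT hρ v).carrier i ⊆ (C.edgeCell hT hρ e).carrier i) ↔
      ∀ i, C.vert v i = C.vert e.1 i ∨ C.vert v i = C.vert (e.1 * wordElt gammaRels [e.2]) i :=
    forall_congr' fun i => Set.singleton_subset_iff
  rw [h]
  constructor
  · exact C.eq_or_eq_of_vert hT hρ e.1 e.2 v
  · rintro (rfl | rfl)
    · exact fun i => .inl rfl
    · exact fun i => .inr rfl

theorem edgeCell_congr {e e' : PresGroup gammaRels × (Gen × Bool)}
    (h : e.1 = e'.1 ∧ e.1 * wordElt gammaRels [e.2] = e'.1 * wordElt gammaRels [e'.2] ∨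
      e.1 = e'.1 * wordElt gammaRels [e'.2] ∧ e.1 * wordElt gammaRels [e.2] = e'.1) :
    C.edgeCell hT hρ e = C.edgeCell hT hρ e' := by
  refine HoroCell.ext (funext fun i => ?_)
  change ({C.vert e.1 i, C.vert (e.1 * wordElt gammaRels [e.2]) i} : Set V) =
    {C.vert e'.1 i, C.vert (e'.1 * wordElt gammaRels [e'.2]) i}
  rcases h with ⟨h1, h2⟩ | ⟨h1, h2⟩
  · rw [h2, h1]
  · rw [h2, h1, Set.pair_comm]

theorem ends_of_edgeCell_eq {e e' : PresGroup gammaRels × (Gen × Bool)}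
    (h : C.edgeCell hT hρ e = C.edgeCell hT hρ e') :
    e.1 = e'.1 ∧ e.1 * wordElt gammaRels [e.2] = e'.1 * wordElt gammaRels [e'.2] ∨
      e.1 = e'.1 * wordElt gammaRels [e'.2] ∧ e.1 * wordElt gammaRels [e.2] = e'.1 := by
  have h1 := (C.vertexCell_liesIn_edgeCell hT hρ e e.1).2 (.inl rfl)
  have h2 := (C.vertexCell_liesIn_edgeCell hT hρ e _).2 (.inr rfl)
  rw [h, vertexCell_liesIn_edgeCell] at h1 h2
  have h3 := C.mul_letter_ne hT hρ e.1 e.2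
  grind

theorem edgeCell_eq_iff (e e' : PresGroup gammaRels × (Gen × Bool)) :
    C.edgeCell hT hρ e = C.edgeCell hT hρ e' ↔
      e' = e ∨ e' = (e.1 * wordElt gammaRels [e.2], (e.2.1, !e.2.2)) := by
  have hflip : wordElt gammaRels [(e.2.1, !e.2.2)] = (wordElt gammaRels [e.2])⁻¹ :=
    wordElt_flip _ _ _
  constructor
  · intro h
    rcases C.ends_of_edgeCell_eq hT hρ h with ⟨h1, h2⟩ | ⟨h1, h2⟩
    · left
      rw [h1] at h2
      exact Prod.ext h1.symm (letter_injective (mul_left_cancel h2)).symm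
    · right
      refine Prod.ext h2.symm (letter_injective ?_)
      rw [hflip, eq_inv_iff_mul_eq_one, ← mul_right_inj e'.1, mul_one, ← mul_assoc, ← h1, h2]
  · rintro (rfl | rfl)
    · rfl
    · exact C.edgeCell_congr hT hρ (.inr ⟨by simp [hflip], rfl⟩)

theorem faceCell_carrier (f : PresGroup gammaRels × gammaRels) (i : Fin 3) :
    (C.faceCell hT hρ f).carrier i =
      {w | ∃ e ∈ cayleyPath gammaRels f.1 f.2.1, C.vert e.1 i = w} := rfl

/-- The factors of the cell determine the upper vertices a, and their height sum determines which
kind of triangle it is. The corners are then known in order, the base point being corner 2 for both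
kinds, and the letters of the relator follow from consecutive corners. Surjectivity uses that a
2-cell has 0 < S < 3. -/
theorem faceCell_bijective : Function.Bijective (C.faceCell hT hρ) := by
  constructor
  · intro f f' h
    obtain ⟨a, s, hf⟩ := C.exists_isFaceAt f
    obtain ⟨a', s', hf'⟩ := C.exists_isFaceAt f'
    obtain rfl : a = a' := by
      funext i
      refine treeCell_true_injective hT hρ ?_
      rw [← hf.carrier_eq, ← hf'.carrier_eq, ← C.faceCell_carrier hT hρ, h, faceCell_carrier]
    obtain rfl : s = s' := by
      have h1 := hf.sum_height hT hρ
      rw [hf'.sum_height hT hρ] at h1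
      cases s <;> cases s' <;> simp at h1 <;> rfl
    obtain ⟨g₁, g₂, x₁, x₂, x₃, hr, e1, e2, e3, h0, h1, h2⟩ := hf
    obtain ⟨g₁', g₂', x₁', x₂', x₃', hr', e1', e2', e3', h0', h1', h2'⟩ := hf'
    have hg : f.1 = f'.1 := C.vert_injective fun i => (h0 i).trans (h0' i).symm
    obtain rfl : g₁ = g₁' := C.vert_injective fun i => (h1 i).trans (h1' i).symm
    obtain rfl : g₂ = g₂' := C.vert_injective fun i => (h2 i).trans (h2' i).symm
    rw [← hg] at e1' e3'
    obtain rfl := letter_injective (mul_left_cancel (e1.trans e1'.symm))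
    obtain rfl := letter_injective (mul_left_cancel (e2.trans e2'.symm))
    obtain rfl := letter_injective (mul_left_cancel (e3.trans e3'.symm))
    exact Prod.ext hg (Subtype.ext (hr.trans hr'.symm))
  · intro c
    obtain ⟨a, b, hc, h1, h2, h3⟩ := c.exists_treeCell hT hρ
    have hb : edgeCount b = 3 := by omega
    have hb' : b = fun _ => true := by
      clear hc h1 h2 h3
      revert b
      decide
    obtain ⟨s, hs⟩ : ∃ s : Bool, ∑ j, vertexHeight T ρ (a j) = if s then 1 else 2 := by
      by_cases h : ∑ j, vertexHeight T ρ (a j) = 1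
      · exact ⟨true, h⟩
      · exact ⟨false, by simp; omega⟩
    obtain ⟨f, hf⟩ := C.exists_isFaceAt_of_sum hT hρ a s hs
    refine ⟨f, HoroCell.ext (funext fun i => ?_)⟩
    rw [hc, hb']
    exact hf.carrier_eq i

theorem vertexCell_liesIn_faceCell_iff (f : PresGroup gammaRels × gammaRels)
    (v : PresGroup gammaRels) : (C.vertexCell hT hρ v).LiesIn (C.faceCell hT hρ f) ↔
      ∃ e ∈ cayleyPath gammaRels f.1 f.2.1, e.1 = v := by
  rw [HoroCell.liesIn_iff]
  constructor
  · intro h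
    obtain ⟨a, s, hf⟩ := C.exists_isFaceAt f
    have hv : ∀ j, C.vert v j ∈ treeCell T ρ (a j) true := fun j => by
      rw [← hf.carrier_eq]
      exact h j rfl
    obtain ⟨i, hi⟩ := C.exists_eq_corner hT hρ a s (hf.sum_height hT hρ) v hv
    obtain ⟨g₁, g₂, x₁, x₂, x₃, hr, rfl, rfl, e3, h0, h1, h2⟩ := hf
    have hx : f.1 = v ∨ f.1 * wordElt gammaRels [x₁] = v ∨
        f.1 * wordElt gammaRels [x₁] * wordElt gammaRels [x₂] = v := by
      fin_cases i
      · exact .inr (.inl (C.vert_injective fun j => (h1 j).trans (hi j).symm))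
      · exact .inr (.inr (C.vert_injective fun j => (h2 j).trans (hi j).symm))
      · exact .inl (C.vert_injective fun j => (h0 j).trans (hi j).symm)
    rw [hr]
    simpa [cayleyPath] using hx
  · rintro ⟨e, he, rfl⟩ i w rfl
    exact ⟨e, he, rfl⟩

/-- Containment can be tested on end points, and the vertices in the closed cell are the three
corners. An edge has distinct ends, and any two corners of a triangle are joined by a side of the
boundary loop. -/
theorem edgeCell_liesIn_faceCell_iff (f : PresGroup gammaRels × gammaRels)
    (c : HoroCell 2 T ρ 1) : c.LiesIn (C.faceCell hT hρ f) ↔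
      c ∈ (cayleyPath gammaRels f.1 f.2.1).map (C.edgeCell hT hρ) := by
  obtain ⟨e, rfl⟩ := C.edgeCell_surjective hT hρ c
  have key : (C.edgeCell hT hρ e).LiesIn (C.faceCell hT hρ f) ↔
      (C.vertexCell hT hρ e.1).LiesIn (C.faceCell hT hρ f) ∧
      (C.vertexCell hT hρ (e.1 * wordElt gammaRels [e.2])).LiesIn (C.faceCell hT hρ f) := by
    simp only [HoroCell.liesIn_iff, ← forall_and]
    exact forall_congr' fun i => by
      refine Set.insert_subset_iff.trans ?_
      rw [← Set.singleton_subset_iff]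
      rfl
  obtain ⟨a, s, g₁, g₂, x₁, x₂, x₃, hr, e1, e2, e3, -⟩ := C.exists_isFaceAt f
  rw [key, vertexCell_liesIn_faceCell_iff, vertexCell_liesIn_faceCell_iff, hr]
  simp only [cayleyPath, e1, e2, List.map_cons, List.map_nil, List.mem_cons, List.not_mem_nil,
    or_false, exists_eq_or_imp, exists_eq_left]
  have hne := C.mul_letter_ne hT hρ e.1 e.2
  constructor
  · rintro ⟨h1 | h1 | h1, h2 | h2 | h2⟩
    · exact absurd (h2.symm.trans h1) hne
    · exact .inl (C.edgeCell_congr hT hρ (.inl ⟨h1.symm, h2.symm.trans e1.symm⟩))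
    · exact .inr (.inr (C.edgeCell_congr hT hρ (.inr ⟨h1.symm.trans e3.symm, h2.symm⟩)))
    · exact .inl (C.edgeCell_congr hT hρ (.inr ⟨h1.symm.trans e1.symm, h2.symm⟩))
    · exact absurd (h2.symm.trans h1) hne
    · exact .inr (.inl (C.edgeCell_congr hT hρ (.inl ⟨h1.symm, h2.symm.trans e2.symm⟩)))
    · exact .inr (.inr (C.edgeCell_congr hT hρ (.inl ⟨h1.symm, h2.symm.trans e3.symm⟩)))
    · exact .inr (.inl (C.edgeCell_congr hT hρ (.inr ⟨h1.symm.trans e2.symm, h2.symm⟩)))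
    · exact absurd (h2.symm.trans h1) hne
  · intro h
    rcases h with h | h | h
    all_goals
      have h' := C.ends_of_edgeCell_eq hT hρ h
      simp only [e1, e2, e3] at h'
      rcases h' with ⟨h1, h2⟩ | ⟨h1, h2⟩ <;> rw [h2, h1] <;> simp

theorem nodup_map_edgeCell (f : PresGroup gammaRels × gammaRels) :
    ((cayleyPath gammaRels f.1 f.2.1).map (C.edgeCell hT hρ)).Nodup := by
  obtain ⟨a, s, g₁, g₂, x₁, x₂, x₃, hr, e1, e2, e3, -⟩ := C.exists_isFaceAt f
  have n1 := C.mul_letter_ne hT hρ f.1 x₁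
  have n2 := C.mul_letter_ne hT hρ g₁ x₂
  have n3 := C.mul_letter_ne hT hρ g₂ x₃
  rw [e1] at n1
  rw [e2] at n2
  rw [e3] at n3
  rw [hr]
  simp only [cayleyPath, e1, e2, List.map_cons, List.map_nil, List.nodup_cons, List.mem_cons,
    List.not_mem_nil, or_false, not_or, List.nodup_nil, not_false_eq_true, and_true]
  refine ⟨⟨fun h => ?_, fun h => ?_⟩, fun h => ?_⟩
  all_goals
    have h' := C.ends_of_edgeCell_eq hT hρ h
    simp only [e1, e2, e3] at h'
    grind

/-- The horocyclic product of three trees is the Cayley 2-complex of the presentation of `Γ₂`. -/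
noncomputable def horoIso : HoroIso (cayleyComplex gammaRels) T ρ where
  onV := Equiv.ofBijective _ (C.vertexCell_bijective hT hρ)
  onE := C.edgeCell hT hρ
  onF := Equiv.ofBijective _ (C.faceCell_bijective hT hρ)
  onE_surjective := C.edgeCell_surjective hT hρ
  onE_eq_iff := C.edgeCell_eq_iff hT hρ
  ends := C.vertexCell_liesIn_edgeCell hT hρ
  boundary_nodup := C.nodup_map_edgeCell hT hρ
  boundary := C.edgeCell_liesIn_faceCell_iff hT hρ

end TreeCoordinates

theorem theorem1p3 {V : Type*} (T : SimpleGraph V) (hT : IsBranchingTree ℤ T)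
    (ρ : ℤ → V) (hρ : IsGeodesicLine T ρ) :
    (∃ e : PresGroup gammaRels ≃* Gamma2, ∀ i : ℤ,
      e (PresentedGroup.of (Gen.lam i)) = ⟨(i : LaurentRing), (1, 0)⟩ ∧
      e (PresentedGroup.of (Gen.mu i)) = ⟨(i : LaurentRing), (0, 1)⟩ ∧
      e (PresentedGroup.of (Gen.nu i)) =
        (⟨(i : LaurentRing), (1, 0)⟩ : Gamma2) * (⟨(i : LaurentRing), (0, 1)⟩ : Gamma2)⁻¹) ∧
    (cayleyProjection gammaRels).IsUniversalCover ∧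
    Nonempty (HoroIso (cayleyComplex gammaRels) T ρ) := by
  obtain ⟨C⟩ := exists_treeCoordinates hT hρ
  exact ⟨⟨presEquivGamma, fun i => ⟨presEquivGamma_of _, presEquivGamma_of _, presEquivGamma_of _⟩⟩,
    isUniversalCover_cayleyProjection gammaRels, ⟨C.horoIso hT.1 hρ⟩⟩
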